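/- The base field is $\mathbb{C}$, $G$ is a finite group, and all $G$-modules are finite dimensional complex representations. A covariant of $G$ is a $G$-equivariant morphism $\phi\colon V\to W$ of $G$-modules, and a rational covariant is a $G$-equivariant rational map $\phi\colon V\dashrightarrow W$. Its dimension is the dimension of the Zariski closure $\overline{\phi(V)}$, and it is called faithful if $G$ acts faithfully on the image $\phi(V)$. The covariant dimension $\operatorname{covdim} G$ (resp. the essential dimension $\operatorname{edim} G$) is the minimum of $\dim\phi$ over all faithful covariants (resp. faithful rational covariants) $\phi$ of $G$. A finite group is called faithful if it admits a faithful irreducible complex representation. Let $Z(G)$ be the center and $[G,G]$ the commutator subgroup of $G$. Corollary 3.6. Suppose that $Z(G)$ is cyclic and non-trivial, that $Z(G)\cap[G,G]=\{e\}$, and that $G/Z(G)$ is faithful. Then $G$ is faithful. If moreover $G$ is non-abelian (equivalently, $G/Z(G)$ is non-trivial), then $$\operatorname{edim} G=\operatorname{covdim} G=\operatorname{covdim} G/Z(G)=\operatorname{edim} G/Z(G)+1.$$ -/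

import Mathlib

namespace CovDim

noncomputable section

/-- The dimension of the Zariski closure of a subset `S` of affine space `ℂᵐ`: the Krull dimension
of the coordinate ring `ℂ[x₁, …, xₘ] / I(S)` of the closure. -/
def closureDim {m : ℕ} (S : Set (Fin m → ℂ)) : WithBot ℕ∞ :=
  ringKrullDim (MvPolynomial (Fin m) ℂ ⧸ MvPolynomial.vanishingIdeal ℂ S)

/-- A morphism of affine spaces `ℂⁿ → ℂᵐ`, given by its polynomial components. -/
abbrev RegularMap (n m : ℕ) : Type := Fin m → MvPolynomial (Fin n) ℂ

/-- The underlying map `ℂⁿ → ℂᵐ` of a morphism. -/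
def RegularMap.toFun {n m : ℕ} (φ : RegularMap n m) (v : Fin n → ℂ) : Fin m → ℂ :=
  fun j => MvPolynomial.eval v (φ j)

/-- The image `φ(ℂⁿ)` of a morphism. -/
def RegularMap.image {n m : ℕ} (φ : RegularMap n m) : Set (Fin m → ℂ) :=
  Set.range φ.toFun

/-- A rational map `ℂⁿ ⇢ ℂᵐ`, represented by its components `num j / den` written over a common
nonzero denominator; it is defined on the dense open set where `den` does not vanish.
Each notion used below (equivariance, faithfulness, dimension) is independent
of the chosen representative. -/
structure RationalMap (n m : ℕ) where
  num : Fin m → MvPolynomial (Fin n) ℂ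
  den : MvPolynomial (Fin n) ℂ
  den_ne_zero : den ≠ 0

/-- The dense open subset `{den ≠ 0}` of `ℂⁿ` on which the rational map is evaluated. -/
def RationalMap.domain {n m : ℕ} (ψ : RationalMap n m) : Set (Fin n → ℂ) :=
  {v | MvPolynomial.eval v ψ.den ≠ 0}

/-- The value of a rational map; it is only used at points of `ψ.domain`. -/
def RationalMap.toFun {n m : ℕ} (ψ : RationalMap n m) (v : Fin n → ℂ) : Fin m → ℂ :=
  fun j => MvPolynomial.eval v (ψ.num j) / MvPolynomial.eval v ψ.den

/-- The image of a rational map. -/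
def RationalMap.image {n m : ℕ} (ψ : RationalMap n m) : Set (Fin m → ℂ) :=
  ψ.toFun '' ψ.domain

section Group

variable {G : Type*} [Group G] {n m : ℕ}

/-- `φ : V → W` is a (regular) covariant, i.e. a `G`-equivariant morphism, where `V` and `W` are
the `G`-modules `(ℂⁿ, ρ)` and `(ℂᵐ, σ)`. Every finite dimensional `G`-module is isomorphic to one
of this form. -/
def IsCovariant (ρ : Representation ℂ G (Fin n → ℂ)) (σ : Representation ℂ G (Fin m → ℂ))
    (φ : RegularMap n m) : Prop :=
  ∀ (g : G) (v : Fin n → ℂ), φ.toFun (ρ g v) = σ g (φ.toFun v)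

/-- `ψ : V ⇢ W` is a rational covariant, i.e. a `G`-equivariant rational map: it commutes with `g`
at all points `v` for which both `v` and `g v` lie in the domain (a dense set). -/
def IsRationalCovariant (ρ : Representation ℂ G (Fin n → ℂ))
    (σ : Representation ℂ G (Fin m → ℂ)) (ψ : RationalMap n m) : Prop :=
  ∀ (g : G) (v : Fin n → ℂ), v ∈ ψ.domain → ρ g v ∈ ψ.domain →
    ψ.toFun (ρ g v) = σ g (ψ.toFun v)

/-- `G` acts faithfully on the subset `S` of the `G`-module `(ℂᵐ, σ)`: only `1` fixes `S`
pointwise. -/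
def ActsFaithfullyOn (σ : Representation ℂ G (Fin m → ℂ)) (S : Set (Fin m → ℂ)) : Prop :=
  ∀ g : G, (∀ w ∈ S, σ g w = w) → g = 1

end Group

/-- The covariant dimension of `G`: the minimum of the dimensions of (the closures of) the images
of all faithful covariants of `G`. -/
def covdim (G : Type*) [Group G] : ℕ :=
  sInf {d : ℕ | ∃ (n m : ℕ) (ρ : Representation ℂ G (Fin n → ℂ))
    (σ : Representation ℂ G (Fin m → ℂ)) (φ : RegularMap n m),
      IsCovariant ρ σ φ ∧ ActsFaithfullyOn σ φ.image ∧
        closureDim φ.image = ((d : ℕ∞) : WithBot ℕ∞)}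

/-- The essential dimension of `G`: the minimum of the dimensions of (the closures of) the images
of all faithful rational covariants of `G`. -/
def edim (G : Type*) [Group G] : ℕ :=
  sInf {d : ℕ | ∃ (n m : ℕ) (ρ : Representation ℂ G (Fin n → ℂ))
    (σ : Representation ℂ G (Fin m → ℂ)) (ψ : RationalMap n m),
      IsRationalCovariant ρ σ ψ ∧ ActsFaithfullyOn σ ψ.image ∧
        closureDim ψ.image = ((d : ℕ∞) : WithBot ℕ∞)}

/-- A group is faithful if it has a faithful irreducible finite dimensional complex
representation. -/
def IsFaithfulGroup (G : Type*) [Group G] : Prop :=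
  ∃ (n : ℕ) (ρ : Representation ℂ G (Fin n → ℂ)),
    ρ.IsIrreducible ∧ Function.Injective ρ

end

end CovDim

/-! Put `Q = G/Z(G)` and let `τ` be a faithful irreducible representation of `Q`. A commutator
argument gives `Z(Q) = 1`. As `Z(G)` is cyclic and embeds in the abelianization, some character `χ`
of `G` is injective on `Z(G)`, and `χ ⊗ τ` is then faithful and irreducible for `G`.

Over a faithful irreducible module, interpolation on free orbits turns a minimal (rational)
covariant into a nonzero self-covariant of no larger dimension, and nonzero already means faithful.
The engine is `closureDim_image_homogeneousComponent_le`: if `p` and `q` have top degrees `a ≠ b`,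
the leading form of `p` has image of dimension at most that of `p/q`. Hence covariants may be taken
homogeneous. If moreover a central element acts by a scalar `c ≠ 1` and `q` is invariant, then `c ^
a = c` and `c ^ b = 1`, so `a ≠ b` and `edim G = covdim G`.

Homogeneous covariants pass between `G` and `Q`: downwards after twisting the target by a power of
`χ`, upwards after multiplying by a homogeneous invariant of suitable degree. Since `Z(Q) = 1`, such
invariants exist in every residue class of degrees (`exists_homogeneous_invariant`).

For `Q`, clearing denominators costs at most one dimension. Conversely, rescaling a homogeneous
covariant `φ` by an invariant function of degree `-1` in `φ` pushes the cone `φ(V)` into a proper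
hypersurface of itself, so the gap is exactly one. -/

namespace CovDim

open MvPolynomial

/-! ### Krull dimension and transcendence degree -/

section KrullDimension

/-- Incomparability gives one inequality; lying over and going up lift chains for the other. -/
theorem ringKrullDim_eq_of_isIntegral_of_injective {R S : Type*} [CommRing R] [CommRing S]
    [Algebra R S] [Algebra.IsIntegral R S] (hinj : Function.Injective (algebraMap R S)) :
    ringKrullDim S = ringKrullDim R := by
  apply le_antisymm
  · refine Order.krullDim_le_of_strictMono (PrimeSpectrum.comap (algebraMap R S)) ?_
    intro P Q hPQ
    exact Ideal.IsIntegral.comap_lt_comap (R := R) (I := P.asIdeal) (J := Q.asIdeal) hPQ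
  · refine iSup_le fun l => ?_
    obtain ⟨Q, -, hQ, hQl⟩ := Ideal.exists_ideal_over_prime_of_isIntegral (S := S)
      l.head.asIdeal ⊥ (by
        rw [← RingHom.ker_eq_comap_bot, (RingHom.injective_iff_ker_eq_bot _).1 hinj]
        exact bot_le)
    have : Q.LiesOver (RelSeries.head l).asIdeal := ⟨hQl.symm⟩
    obtain ⟨L, hL, -⟩ := Ideal.exists_ltSeries_of_hasGoingUp l Q
    rw [← hL]
    exact le_iSup (fun p : LTSeries (PrimeSpectrum S) => (p.length : WithBot ℕ∞)) L

/-- Noether normalization: a single polynomial subring computes both invariants. -/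
theorem exists_ringKrullDim_eq_and_trdeg_eq (k A : Type*) [Field k] [CommRing A] [IsDomain A]
    [Algebra k A] [Algebra.FiniteType k A] :
    ∃ s : ℕ, ringKrullDim A = (s : ℕ∞) ∧ Algebra.trdeg k A = s := by
  obtain ⟨s, g, hg, hint⟩ := exists_integral_inj_algHom_of_fg k A
  refine ⟨s, ?_, ?_⟩
  · algebraize [g.toRingHom]
    have : Algebra.IsIntegral (MvPolynomial (Fin s) k) A := ⟨hint⟩
    rw [ringKrullDim_eq_of_isIntegral_of_injective (R := MvPolynomial (Fin s) k) hg,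
      MvPolynomial.ringKrullDim_of_isNoetherianRing]
    simp
  · have hind : AlgebraicIndependent k (fun i => g (X i)) := by
      rw [algebraicIndependent_iff_injective_aeval]
      convert hg
      ext i; simp
    have halg : Algebra.IsAlgebraic (Algebra.adjoin k (Set.range fun i => g (X i))) A := by
      refine ⟨fun a => ?_⟩
      obtain ⟨P, hP, hPa⟩ := hint a
      refine IsIntegral.isAlgebraic ?_
      have hmem : ∀ x, g x ∈ Algebra.adjoin k (Set.range fun i => g (X i)) := by
        intro x
        rw [Algebra.adjoin_range_eq_range_aeval]
        refine ⟨x, ?_⟩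
        have : (aeval fun i => g (X i)) = g := by ext i; simp
        exact congrArg (fun f : _ →ₐ[k] A => f x) this
      let g' : MvPolynomial (Fin s) k →+* Algebra.adjoin k (Set.range fun i => g (X i)) :=
        (g.codRestrict _ hmem : _ →ₐ[k] _)
      refine ⟨P.map g', hP.map _, ?_⟩
      rw [Polynomial.eval₂_map]
      exact hPa
    have hb : IsTranscendenceBasis k (fun i => g (X i)) := by
      have : FaithfulSMul k A := inferInstance
      exact (hind.isTranscendenceBasis_iff_isAlgebraic).2 halg
    have := hb.lift_cardinalMk_eq_trdeg
    simpa using this.symm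

end KrullDimension

/-! ### Dimension as the number of independent functions -/

section Independence

variable {m : ℕ} {S : Set (Fin m → ℂ)}

/-- No nonzero polynomial relation between the functions `f i` holds on `S`. -/
def IndepOn {ι : Type*} (S : Set (Fin m → ℂ)) (f : ι → MvPolynomial (Fin m) ℂ) : Prop :=
  ∀ P : MvPolynomial ι ℂ, (∀ x ∈ S, eval (fun i => eval x (f i)) P = 0) → P = 0

theorem indepOn_iff_algebraicIndependent {ι : Type*} (f : ι → MvPolynomial (Fin m) ℂ) :
    IndepOn S f ↔ AlgebraicIndependent ℂ
      (fun i => Ideal.Quotient.mk (vanishingIdeal ℂ S) (f i)) := by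
  rw [algebraicIndependent_iff]
  refine forall_congr' fun P => ?_
  have h : aeval (fun i => Ideal.Quotient.mk (vanishingIdeal ℂ S) (f i)) P
      = Ideal.Quotient.mk (vanishingIdeal ℂ S) (aeval f P) := by
    rw [← Ideal.Quotient.mkₐ_eq_mk ℂ, ← comp_aeval_apply]
  rw [h, Ideal.Quotient.eq_zero_iff_mem, mem_vanishingIdeal_iff]
  have h2 : ∀ x : Fin m → ℂ, aeval x (aeval f P) = eval (fun i => eval x (f i)) P := by
    intro x
    rw [comp_aeval_apply]
    simp
  simp only [h2]

theorem IndepOn.card_le_closureDim (hS : (vanishingIdeal ℂ S).IsPrime) {ι : Type}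
    [Fintype ι] {f : ι → MvPolynomial (Fin m) ℂ} (hf : IndepOn S f) :
    ((Fintype.card ι : ℕ∞) : WithBot ℕ∞) ≤ closureDim S := by
  obtain ⟨s, hs, ht⟩ := exists_ringKrullDim_eq_and_trdeg_eq ℂ
    (MvPolynomial (Fin m) ℂ ⧸ vanishingIdeal ℂ S)
  rw [closureDim, hs]
  have := ((indepOn_iff_algebraicIndependent f).1 hf).cardinalMk_le_trdeg
  rw [ht, Cardinal.mk_fintype] at this
  exact_mod_cast this

theorem exists_indepOn_closureDim_eq (hS : (vanishingIdeal ℂ S).IsPrime) :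
    ∃ s : Finset (Fin m), IndepOn S (fun i : s => (X i.1 : MvPolynomial (Fin m) ℂ)) ∧
      closureDim S = ((s.card : ℕ∞) : WithBot ℕ∞) := by
  classical
  obtain ⟨d, hd, ht⟩ := exists_ringKrullDim_eq_and_trdeg_eq ℂ
    (MvPolynomial (Fin m) ℂ ⧸ vanishingIdeal ℂ S)
  let x : Fin m → MvPolynomial (Fin m) ℂ ⧸ vanishingIdeal ℂ S :=
    fun i => Ideal.Quotient.mk _ (X i)
  have htop : Algebra.adjoin ℂ (Set.range x) = ⊤ := by
    rw [Algebra.adjoin_range_eq_range_aeval, AlgHom.range_eq_top]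
    intro a
    obtain ⟨P, rfl⟩ := Ideal.Quotient.mk_surjective a
    refine ⟨P, ?_⟩
    have : aeval x = Ideal.Quotient.mkₐ ℂ (vanishingIdeal ℂ S) := by ext i; simp [x]
    rw [this]; rfl
  have : Algebra.IsAlgebraic (Algebra.adjoin ℂ (Set.range x))
      (MvPolynomial (Fin m) ℂ ⧸ vanishingIdeal ℂ S) := by
    refine ⟨fun a => ?_⟩
    have ha : a ∈ Algebra.adjoin ℂ (Set.range x) := htop ▸ Algebra.mem_top
    exact isAlgebraic_algebraMap (⟨a, ha⟩ : Algebra.adjoin ℂ (Set.range x))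
  obtain ⟨t, htx, hb⟩ := exists_isTranscendenceBasis_subset (R := ℂ) (Set.range x)
  -- Distinct coordinates may agree on `S`, so one index is kept for each basis element.
  obtain ⟨s, -, hbij⟩ := Set.SurjOn.exists_bijOn_subset (s := Set.univ) (f := x) (t := t)
    (by rwa [Set.SurjOn, Set.image_univ])
  have hcard : s.toFinset.card = d := by
    have := hb.cardinalMk_eq_trdeg
    rw [ht, Cardinal.mk_congr (Set.BijOn.equiv x hbij).symm, Cardinal.mk_fintype,
      Nat.cast_inj] at this
    rw [← this, Set.toFinset_card]
  refine ⟨s.toFinset, ?_, ?_⟩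
  · rw [indepOn_iff_algebraicIndependent]
    have hmem : ∀ i : s.toFinset, i.1 ∈ s := fun i => Set.mem_toFinset.1 i.2
    refine hb.1.comp (fun i : s.toFinset => (⟨x i.1, hbij.mapsTo (hmem i)⟩ : t)) ?_
    intro i j hij
    exact Subtype.ext (hbij.injOn (hmem i) (hmem j) (congrArg Subtype.val hij))
  · rw [closureDim, hd, hcard]

theorem closureDim_mono {S T : Set (Fin m → ℂ)} (h : S ⊆ T) : closureDim S ≤ closureDim T :=
  ringKrullDim_le_of_surjective (Ideal.Quotient.factor (vanishingIdeal_anti_mono h))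
    (Ideal.Quotient.factor_surjective _)

/-- The class of `P` is a nonzero element of a domain that dies in the coordinate ring of `T`, so
chains of primes for `T` extend by the zero ideal. -/
theorem closureDim_add_one_le {S T : Set (Fin m → ℂ)} (hS : (vanishingIdeal ℂ S).IsPrime)
    (h : T ⊆ S) (P : MvPolynomial (Fin m) ℂ) (hT : ∀ x ∈ T, eval x P = 0)
    {x : Fin m → ℂ} (hx : x ∈ S) (hPx : eval x P ≠ 0) :
    closureDim T + 1 ≤ closureDim S := by
  refine ringKrullDim_succ_le_of_surjective (Ideal.Quotient.factor (vanishingIdeal_anti_mono h))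
    (Ideal.Quotient.factor_surjective _) (r := Ideal.Quotient.mk _ P) ?_ ?_
  · rw [mem_nonZeroDivisors_iff_ne_zero, Ne, Ideal.Quotient.eq_zero_iff_mem,
      mem_vanishingIdeal_iff]
    intro hP
    exact hPx (by simpa [coe_aeval_eq_eval] using hP x hx)
  · rw [Ideal.Quotient.factor_mk, Ideal.Quotient.eq_zero_iff_mem, mem_vanishingIdeal_iff]
    intro x hx
    simpa [coe_aeval_eq_eval] using hT x hx

theorem closureDim_eq_natCast (hS : (vanishingIdeal ℂ S).IsPrime) :
    ∃ d : ℕ, closureDim S = ((d : ℕ∞) : WithBot ℕ∞) :=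
  let ⟨s, _, hs⟩ := exists_indepOn_closureDim_eq hS
  ⟨s.card, hs⟩

theorem isPrime_vanishingIdeal_image {m' : ℕ} (hS : (vanishingIdeal ℂ S).IsPrime)
    (β : RegularMap m m') : (vanishingIdeal ℂ (β.toFun '' S)).IsPrime := by
  have h : vanishingIdeal ℂ (β.toFun '' S) = (vanishingIdeal ℂ S).comap (aeval β).toRingHom := by
    ext P
    simp only [mem_vanishingIdeal_iff, Ideal.mem_comap, Set.forall_mem_image]
    refine forall₂_congr fun x _ => ?_
    change _ ↔ aeval x (aeval β P) = 0
    rw [comp_aeval_apply]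
    rfl
  rw [h]
  exact Ideal.comap_isPrime _ _

/-- Independent coordinates on the image pull back to independent functions on the source. -/
theorem closureDim_image_le {m' : ℕ} (hS : (vanishingIdeal ℂ S).IsPrime) (β : RegularMap m m') :
    closureDim (β.toFun '' S) ≤ closureDim S := by
  obtain ⟨s, hs, hd⟩ := exists_indepOn_closureDim_eq (isPrime_vanishingIdeal_image hS β)
  rw [hd, ← Fintype.card_coe]
  refine IndepOn.card_le_closureDim hS (f := fun i : s => β i) fun P hP => hs P ?_
  rintro _ ⟨x, hx, rfl⟩
  simpa [RegularMap.toFun] using hP x hx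

theorem closureDim_le_closureDim_tail_add_one {S : Set (Fin (m + 1) → ℂ)}
    (hS : (vanishingIdeal ℂ S).IsPrime)
    (hS' : (vanishingIdeal ℂ ((fun x : Fin (m + 1) → ℂ => Fin.tail x) '' S)).IsPrime) :
    closureDim S ≤ closureDim ((fun x : Fin (m + 1) → ℂ => Fin.tail x) '' S) + 1 := by
  classical
  obtain ⟨s, hs, hd⟩ := exists_indepOn_closureDim_eq hS
  let s' : Finset (Fin m) := Finset.univ.filter fun i => i.succ ∈ s
  have hcard : s.card ≤ s'.card + 1 := by
    have hsub : s ⊆ insert 0 (s'.image Fin.succ) := by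
      intro i hi
      refine Fin.cases (fun _ => by simp) (fun j hj => ?_) i hi
      simp [s', hj]
    refine (Finset.card_le_card hsub).trans ((Finset.card_insert_le _ _).trans ?_)
    gcongr
    exact Finset.card_image_le
  have hind : IndepOn ((fun x : Fin (m + 1) → ℂ => Fin.tail x) '' S)
      (fun i : s' => (X i.1 : MvPolynomial (Fin m) ℂ)) := by
    intro P hP
    let e : s' → s := fun i => ⟨i.1.succ, (Finset.mem_filter.1 i.2).2⟩
    have he : Function.Injective e := fun i j hij =>
      Subtype.ext (Fin.succ_injective _ (congrArg Subtype.val hij))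
    refine rename_injective e he ?_
    rw [map_zero]
    refine hs _ fun x hx => ?_
    rw [eval_rename]
    simpa [Function.comp_def, e, Fin.tail] using hP _ ⟨x, hx, rfl⟩
  rw [hd]
  have h := hind.card_le_closureDim hS'
  rw [Fintype.card_coe] at h
  calc (((s.card : ℕ) : ℕ∞) : WithBot ℕ∞) ≤ ((s'.card : ℕ∞) : WithBot ℕ∞) + 1 := by
        exact_mod_cast hcard
    _ ≤ _ := by gcongr

end Independence

/-! ### Rational maps and clearing denominators -/

section Rational

variable {n m : ℕ}

theorem eq_zero_of_forall_eval_ne_zero {P q : MvPolynomial (Fin n) ℂ} (hq : q ≠ 0)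
    (h : ∀ v, eval v q ≠ 0 → eval v P = 0) : P = 0 := by
  have : P * q = 0 := by
    refine MvPolynomial.funext fun v => ?_
    by_cases hv : eval v q = 0 <;> simp [hv, h v]
  exact (mul_eq_zero.1 this).resolve_right hq

theorem exists_eval_ne_zero {P : MvPolynomial (Fin n) ℂ} (hP : P ≠ 0) : ∃ v, eval v P ≠ 0 := by
  by_contra! h
  exact hP (MvPolynomial.funext fun v => by simp [h v])

theorem RegularMap.eval_aeval (φ : RegularMap n m) (P : MvPolynomial (Fin m) ℂ) (v : Fin n → ℂ) :
    eval v (aeval φ P) = eval (φ.toFun v) P := by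
  rw [← coe_aeval_eq_eval, RingHom.coe_coe, comp_aeval_apply]
  rfl

/-- Having every large exponent available lets several polynomials share one power of the
denominator. -/
theorem RationalMap.exists_eval_eq_pow_mul (ψ : RationalMap n m) (P : MvPolynomial (Fin m) ℂ) :
    ∃ K₀ : ℕ, ∀ K ≥ K₀, ∃ r : MvPolynomial (Fin n) ℂ, ∀ v ∈ ψ.domain,
      eval v r = eval v ψ.den ^ K * eval (ψ.toFun v) P := by
  induction P using MvPolynomial.induction_on with
  | C a => exact ⟨0, fun K _ => ⟨ψ.den ^ K * C a, fun v _ => by simp⟩⟩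
  | add P Q hP hQ =>
    obtain ⟨K₁, h₁⟩ := hP
    obtain ⟨K₂, h₂⟩ := hQ
    refine ⟨max K₁ K₂, fun K hK => ?_⟩
    obtain ⟨r₁, h₁⟩ := h₁ K (le_trans (le_max_left _ _) hK)
    obtain ⟨r₂, h₂⟩ := h₂ K (le_trans (le_max_right _ _) hK)
    exact ⟨r₁ + r₂, fun v hv => by simp [h₁ v hv, h₂ v hv, mul_add]⟩
  | mul_X P i hP =>
    obtain ⟨K₁, h₁⟩ := hP
    refine ⟨K₁ + 1, fun K hK => ?_⟩
    obtain ⟨L, rfl⟩ : ∃ L, K = L + 1 := ⟨K - 1, by omega⟩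
    obtain ⟨r₁, h₁⟩ := h₁ L (by omega)
    refine ⟨r₁ * ψ.num i, fun v hv => ?_⟩
    have hv' : eval v ψ.den ≠ 0 := hv
    rw [map_mul, map_mul, h₁ v hv, eval_X, pow_succ]
    simp only [RationalMap.toFun]
    field_simp

theorem RationalMap.isPrime_vanishingIdeal_image (ψ : RationalMap n m) :
    (vanishingIdeal ℂ ψ.image).IsPrime := by
  have key : ∀ P, P ∈ vanishingIdeal ℂ ψ.image ↔ ∀ v ∈ ψ.domain, eval (ψ.toFun v) P = 0 := by
    intro P
    simp [mem_vanishingIdeal_iff, RationalMap.image]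
  refine ⟨?_, ?_⟩
  · rw [Ne, Ideal.eq_top_iff_one, key]
    obtain ⟨v, hv⟩ := exists_eval_ne_zero ψ.den_ne_zero
    intro h
    simpa using h v hv
  · intro P Q hPQ
    rw [key] at hPQ
    obtain ⟨K₁, h₁⟩ := ψ.exists_eval_eq_pow_mul P
    obtain ⟨K₂, h₂⟩ := ψ.exists_eval_eq_pow_mul Q
    obtain ⟨r₁, h₁⟩ := h₁ K₁ le_rfl
    obtain ⟨r₂, h₂⟩ := h₂ K₂ le_rfl
    have h : r₁ * r₂ = 0 := by
      refine eq_zero_of_forall_eval_ne_zero ψ.den_ne_zero fun v hv => ?_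
      have := hPQ v hv
      rw [map_mul] at this
      rw [map_mul, h₁ v hv, h₂ v hv, mul_mul_mul_comm, this, mul_zero]
    simp only [key]
    refine (mul_eq_zero.1 h).imp (fun h0 v hv => ?_) (fun h0 v hv => ?_)
    · have := h₁ v hv
      simpa [h0, show eval v ψ.den ≠ 0 from hv] using this
    · have := h₂ v hv
      simpa [h0, show eval v ψ.den ≠ 0 from hv] using this

/-- A morphism, viewed as a rational map with denominator `1`. -/
noncomputable def RegularMap.toRationalMap (φ : RegularMap n m) : RationalMap n m :=
  ⟨φ, 1, one_ne_zero⟩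

theorem RegularMap.toRationalMap_toFun (φ : RegularMap n m) :
    φ.toRationalMap.toFun = φ.toFun := by
  funext v j
  simp [RegularMap.toRationalMap, RationalMap.toFun, RegularMap.toFun]

theorem RegularMap.toRationalMap_domain (φ : RegularMap n m) :
    φ.toRationalMap.domain = Set.univ := by
  simp [RegularMap.toRationalMap, RationalMap.domain]

theorem RegularMap.toRationalMap_image (φ : RegularMap n m) :
    φ.toRationalMap.image = φ.image := by
  rw [RationalMap.image, φ.toRationalMap_toFun, φ.toRationalMap_domain, Set.image_univ]
  rfl

theorem RegularMap.isPrime_vanishingIdeal_image (φ : RegularMap n m) :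
    (vanishingIdeal ℂ φ.image).IsPrime :=
  φ.toRationalMap_image ▸ φ.toRationalMap.isPrime_vanishingIdeal_image

/-- The numerators are `den · ψ`, hence functions of the pair `(den, ψ)`, which has only one
coordinate more than `ψ`. -/
theorem closureDim_image_num_le (ψ : RationalMap n m) :
    closureDim (RegularMap.image ψ.num) ≤ closureDim ψ.image + 1 := by
  -- The new coordinate is `den`, written `den * den / den` to fit the common denominator.
  let ψ' : RationalMap n (m + 1) := ⟨Fin.cons (ψ.den * ψ.den) ψ.num, ψ.den, ψ.den_ne_zero⟩
  have htail : (fun x : Fin (m + 1) → ℂ => Fin.tail x) '' ψ'.image = ψ.image := by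
    rw [RationalMap.image, RationalMap.image, Set.image_image]
    rfl
  have h0 : ∀ v ∈ ψ.domain, ψ'.toFun v 0 = eval v ψ.den := by
    intro v hv
    have hv' : eval v ψ.den ≠ 0 := hv
    simp only [RationalMap.toFun, ψ', Fin.cons_zero, map_mul]
    field_simp
  have h1 : ∀ v j, ψ'.toFun v (Fin.succ j) = ψ.toFun v j := fun v j => by
    simp [RationalMap.toFun, ψ']
  refine le_trans ?_ (htail ▸ closureDim_le_closureDim_tail_add_one (S := ψ'.image)
    ψ'.isPrime_vanishingIdeal_image (htail.symm ▸ ψ.isPrime_vanishingIdeal_image))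
  obtain ⟨s, hs, hd⟩ := exists_indepOn_closureDim_eq
    (RegularMap.isPrime_vanishingIdeal_image ψ.num)
  rw [hd, ← Fintype.card_coe]
  refine IndepOn.card_le_closureDim ψ'.isPrime_vanishingIdeal_image
    (f := fun i : s => X 0 * X (Fin.succ i)) fun P hP => hs P ?_
  have hz : aeval (fun i : s => ψ.num i) P = 0 := by
    refine eq_zero_of_forall_eval_ne_zero ψ.den_ne_zero fun v hv => ?_
    have := hP _ ⟨v, hv, rfl⟩
    rw [← coe_aeval_eq_eval, RingHom.coe_coe, comp_aeval_apply]
    rw [← coe_aeval_eq_eval, RingHom.coe_coe] at this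
    convert this using 2
    congr 1
    funext i
    rw [map_mul, eval_X, eval_X, h0 v hv, h1, RationalMap.toFun, aeval_eq_eval]
    field_simp
  rintro _ ⟨v, rfl⟩
  have := congrArg (eval v) hz
  rw [← coe_aeval_eq_eval, RingHom.coe_coe, comp_aeval_apply] at this
  simpa [RegularMap.toFun, coe_aeval_eq_eval] using this

end Rational

/-! ### Leading forms do not increase dimension -/

section LeadingForms

variable {n m : ℕ}

/-- The restriction of a polynomial function to the line through `0` and `v`. -/
noncomputable def line {ι : Type*} (v : ι → ℂ) : MvPolynomial ι ℂ →ₐ[ℂ] Polynomial ℂ :=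
  aeval fun i => Polynomial.C (v i) * Polynomial.X

theorem eval_line {ι : Type*} (v : ι → ℂ) (P : MvPolynomial ι ℂ) (t : ℂ) :
    (line v P).eval t = eval (t • v) P := by
  rw [line, ← Polynomial.coe_aeval_eq_eval, comp_aeval_apply,
    ← coe_aeval_eq_eval, RingHom.coe_coe]
  congr 2
  funext i
  rw [Polynomial.coe_aeval_eq_eval, Polynomial.eval_mul, Polynomial.eval_C, Polynomial.eval_X,
    Pi.smul_apply, smul_eq_mul, mul_comm]

theorem line_monomial {ι : Type*} (v : ι → ℂ) (d : ι →₀ ℕ) (a : ℂ) :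
    line v (monomial d a) = Polynomial.C (eval v (monomial d a)) * Polynomial.X ^ d.degree := by
  rw [line, aeval_monomial, eval_monomial, Finsupp.degree_apply]
  simp only [mul_pow, Finsupp.prod, Finset.prod_mul_distrib, Finset.prod_pow_eq_pow_sum]
  simp [mul_assoc]

theorem coeff_line {ι : Type*} (v : ι → ℂ) (P : MvPolynomial ι ℂ) (d : ℕ) :
    (line v P).coeff d = eval v (homogeneousComponent d P) := by
  induction P using MvPolynomial.induction_on' with
  | monomial e a =>
    rw [line_monomial, Polynomial.coeff_C_mul_X_pow]
    split_ifs with h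
    · rw [homogeneousComponent_of_mem (isHomogeneous_monomial a h.symm), if_pos rfl]
    · rw [homogeneousComponent_of_mem (isHomogeneous_monomial a rfl), if_neg h, map_zero]
  | add P Q hP hQ => simp [hP, hQ]

theorem natDegree_line_le {ι : Type*} (v : ι → ℂ) (P : MvPolynomial ι ℂ) :
    (line v P).natDegree ≤ P.totalDegree := by
  rw [Polynomial.natDegree_le_iff_coeff_eq_zero]
  intro d hd
  rw [coeff_line, homogeneousComponent_eq_zero _ _ hd, map_zero]

theorem eval_smul_of_isHomogeneous {ι : Type*} {P : MvPolynomial ι ℂ} {k : ℕ}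
    (hP : P.IsHomogeneous k) (c : ℂ) (x : ι → ℂ) : eval (c • x) P = c ^ k * eval x P := by
  have h : line x P = Polynomial.C (eval x P) * Polynomial.X ^ k := by
    ext d
    rw [coeff_line, Polynomial.coeff_C_mul_X_pow, homogeneousComponent_of_mem hP]
    by_cases hd : d = k
    · rw [if_pos hd, if_pos hd]
    · rw [if_neg hd, if_neg hd, map_zero]
  rw [← eval_line, h, Polynomial.eval_mul, Polynomial.eval_C, Polynomial.eval_pow,
    Polynomial.eval_X, mul_comm]

/-- Substituting polynomials of degree at most `a` into a form amounts, in top degree, to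
substituting their coefficients at `a`. -/
theorem natDegree_aeval_le_and_coeff {ι : Type*} {P : MvPolynomial ι ℂ} {k : ℕ}
    (hP : P.IsHomogeneous k) (f : ι → Polynomial ℂ) (a : ℕ) (hf : ∀ i, (f i).natDegree ≤ a) :
    (aeval f P).natDegree ≤ k * a ∧
      (aeval f P).coeff (k * a) = eval (fun i => (f i).coeff a) P := by
  classical
  have hmon : ∀ d : ι →₀ ℕ, (d.prod fun i e => f i ^ e).natDegree ≤ d.degree * a ∧
      (d.prod fun i e => f i ^ e).coeff (d.degree * a) = d.prod fun i e => (f i).coeff a ^ e := by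
    intro d
    induction d using Finsupp.induction with
    | zero => simp
    | single_add i e d hi he ih =>
      have hd : Disjoint (Finsupp.single i e).support d.support := by
        rw [Finsupp.support_single _ he]
        simpa using hi
      rw [Finsupp.prod_add_index_of_disjoint hd, Finsupp.prod_add_index_of_disjoint hd,
        Finsupp.prod_single_index (by simp), Finsupp.prod_single_index (by simp), map_add,
        Finsupp.degree_single, add_mul]
      have h1 : (f i ^ e).natDegree ≤ e * a := Polynomial.natDegree_pow_le_of_le e (hf i)
      refine ⟨Polynomial.natDegree_mul_le_of_le h1 ih.1, ?_⟩
      rw [Polynomial.coeff_mul_add_eq_of_natDegree_le h1 ih.1, ih.2,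
        Polynomial.coeff_pow_of_natDegree_le (hf i)]
  have hdeg : ∀ d ∈ P.support, d.degree = k := fun d hd => by
    by_contra h
    exact (mem_support_iff.1 hd) (hP.coeff_eq_zero h)
  rw [aeval_def, eval₂_eq, eval_eq]
  constructor
  · refine Polynomial.natDegree_sum_le_of_forall_le _ _ fun d hd => ?_
    refine (Polynomial.natDegree_C_mul_le _ _).trans ?_
    rw [← hdeg d hd]
    exact (hmon d).1
  · rw [Polynomial.finsetSum_coeff]
    refine Finset.sum_congr rfl fun d hd => ?_
    rw [← Polynomial.C_eq_algebraMap, Polynomial.coeff_C_mul, ← hdeg d hd]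
    congr 1
    exact (hmon d).2

/-- Multiply a relation `∑ P_k` among the coordinates of `p/q` by `q ^ K` to get `∑ q ^ (K - k)
P_k(p) = 0`. Since `a ≠ b`, the terms have different degree bounds `(K - k) b + k a`, so the top one
cannot cancel and `P_k(p_a) = 0`. Thus independence for `p_a` implies independence for `p/q`. -/
theorem closureDim_image_homogeneousComponent_le (ψ : RationalMap n m) {a b : ℕ}
    (ha : ∀ j, (ψ.num j).totalDegree ≤ a) (hb : ψ.den.totalDegree ≤ b)
    (hb' : homogeneousComponent b ψ.den ≠ 0) (hab : a ≠ b) :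
    closureDim (RegularMap.image fun j => homogeneousComponent a (ψ.num j)) ≤
      closureDim ψ.image := by
  classical
  set pa : RegularMap n m := fun j => homogeneousComponent a (ψ.num j) with hpa
  obtain ⟨s, hs, hd⟩ := exists_indepOn_closureDim_eq pa.isPrime_vanishingIdeal_image
  rw [hd, ← Fintype.card_coe]
  refine IndepOn.card_le_closureDim ψ.isPrime_vanishingIdeal_image
    (f := fun i : s => X i.1) fun P hP => ?_
  by_contra hP0
  set K := P.totalDegree with hK
  have hsum : P = ∑ k ∈ Finset.range (K + 1), homogeneousComponent k P :=
    (sum_homogeneousComponent P).symm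
  let T := (Finset.range (K + 1)).filter fun k => homogeneousComponent k P ≠ 0
  have hT : T.Nonempty := by
    by_contra hT
    rw [Finset.not_nonempty_iff_eq_empty, Finset.filter_eq_empty_iff] at hT
    refine hP0 (hsum.trans (Finset.sum_eq_zero fun k hk => ?_))
    simpa using hT hk
  -- This degree is affine in `k` with slope `a - b ≠ 0`, so the maximum is attained only once.
  obtain ⟨k, hkT, hmax⟩ := Finset.exists_max_image T (fun k => (K - k) * b + k * a) hT
  obtain ⟨hkK, hk0⟩ := Finset.mem_filter.1 hkT
  rw [Finset.mem_range] at hkK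
  have hlt : ∀ k' ∈ T, k' ≠ k → (K - k') * b + k' * a < (K - k) * b + k * a := by
    intro k' hk' hne
    refine lt_of_le_of_ne (hmax k' hk') fun h => hne ?_
    have hk'K := Finset.mem_range.1 (Finset.mem_filter.1 hk').1
    zify [Nat.lt_succ_iff.1 hkK, Nat.lt_succ_iff.1 hk'K] at h
    have h2 : ((k' : ℤ) - k) * ((a : ℤ) - b) = 0 := by linear_combination h
    rcases mul_eq_zero.1 h2 with h3 | h3 <;> omega
  refine hk0 (hs _ ?_)
  have hzero : aeval (fun i : s => pa i) (homogeneousComponent k P) = 0 := by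
    refine eq_zero_of_forall_eval_ne_zero hb' fun v hv => ?_
    set Q := line v ψ.den with hQ
    let p : s → Polynomial ℂ := fun i => line v (ψ.num i)
    have hQdeg : Q.natDegree ≤ b := (natDegree_line_le v _).trans hb
    have hQb : Q.coeff b = eval v (homogeneousComponent b ψ.den) := coeff_line v _ _
    have hQ0 : Q ≠ 0 := by
      intro h
      rw [h, Polynomial.coeff_zero] at hQb
      exact hv hQb.symm
    have hpdeg : ∀ i, (p i).natDegree ≤ a := fun i => (natDegree_line_le v _).trans (ha i)
    have hrel : ∑ k ∈ Finset.range (K + 1), Q ^ (K - k) * aeval p (homogeneousComponent k P) = 0 := by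
      -- The extra factor `Q` makes the identity trivial at the parameters where the rational map is
      -- undefined.
      refine (mul_eq_zero.1 (?_ : _ * Q = 0)).resolve_right hQ0
      refine Polynomial.funext fun t => ?_
      rw [Polynomial.eval_mul, Polynomial.eval_zero]
      by_cases ht : Q.eval t = 0
      · rw [ht, mul_zero]
      · have hden : Q.eval t = eval (t • v) ψ.den := eval_line v _ t
        have hx := hP (ψ.toFun (t • v)) ⟨t • v, by rw [hden] at ht; exact ht, rfl⟩
        simp only [eval_X] at hx
        have hp : (fun i => (p i).eval t) = Q.eval t • fun i : s => ψ.toFun (t • v) i := by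
          funext i
          rw [Pi.smul_apply, RationalMap.toFun, ← hden, smul_eq_mul, mul_div_cancel₀ _ ht]
          exact eval_line v _ t
        have hev : ∀ R : MvPolynomial s ℂ, (aeval p R).eval t = eval (fun i => (p i).eval t) R := by
          intro R
          rw [← Polynomial.coe_aeval_eq_eval, comp_aeval_apply, aeval_eq_eval]
        rw [Polynomial.eval_finsetSum]
        have : ∀ k ∈ Finset.range (K + 1),
            (Q ^ (K - k) * aeval p (homogeneousComponent k P)).eval t =
              Q.eval t ^ K * eval (fun i : s => ψ.toFun (t • v) i) (homogeneousComponent k P) := by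
          intro k hk
          rw [Polynomial.eval_mul, hev, hp,
            eval_smul_of_isHomogeneous (homogeneousComponent_isHomogeneous k P), Polynomial.eval_pow,
            ← mul_assoc, ← pow_add, Nat.sub_add_cancel (Nat.lt_succ_iff.1 (Finset.mem_range.1 hk))]
        rw [Finset.sum_congr rfl this, ← Finset.mul_sum, ← map_sum, ← hsum, hx, mul_zero, zero_mul]
    have hcoeff := congrArg (fun W => Polynomial.coeff W ((K - k) * b + k * a)) hrel
    simp only [Polynomial.finsetSum_coeff, Polynomial.coeff_zero] at hcoeff
    have hterm : ∀ k, (Q ^ (K - k)).natDegree ≤ (K - k) * b :=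
      fun k => Polynomial.natDegree_pow_le_of_le _ hQdeg
    rw [Finset.sum_eq_single k] at hcoeff
    · obtain ⟨h1, h2⟩ := natDegree_aeval_le_and_coeff
        (homogeneousComponent_isHomogeneous k P) p a hpdeg
      rw [Polynomial.coeff_mul_add_eq_of_natDegree_le (hterm k) h1, h2,
        Polynomial.coeff_pow_of_natDegree_le hQdeg, hQb] at hcoeff
      have := (mul_eq_zero.1 hcoeff).resolve_left (pow_ne_zero _ hv)
      rw [← aeval_eq_eval, comp_aeval_apply]
      simpa only [p, coeff_line, aeval_eq_eval] using this
    · intro k' hk' hne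
      by_cases h0 : homogeneousComponent k' P = 0
      · rw [h0, map_zero, mul_zero, Polynomial.coeff_zero]
      · refine Polynomial.coeff_eq_zero_of_natDegree_lt (lt_of_le_of_lt ?_
          (hlt k' (Finset.mem_filter.2 ⟨hk', h0⟩) hne))
        exact Polynomial.natDegree_mul_le_of_le (hterm k') (natDegree_aeval_le_and_coeff
          (homogeneousComponent_isHomogeneous k' P) p a hpdeg).1
    · intro h
      exact absurd (Finset.mem_range.2 hkK) h
  rintro _ ⟨v, rfl⟩
  have := congrArg (eval v) hzero
  rw [← aeval_eq_eval, comp_aeval_apply, map_zero] at this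
  simpa only [eval_X, RegularMap.toFun, aeval_eq_eval] using this

theorem apply_eq_sum_mul_single (A : (Fin n → ℂ) →ₗ[ℂ] (Fin m → ℂ)) (v : Fin n → ℂ) (j : Fin m) :
    A v j = ∑ i, v i * A (Pi.single i 1) j := by
  conv_lhs => rw [LinearMap.pi_apply_eq_sum_univ A v]
  rw [Finset.sum_apply]
  refine Finset.sum_congr rfl fun i _ => ?_
  have : (fun k => if i = k then (1 : ℂ) else 0) = Pi.single i 1 := by
    funext k
    simp [Pi.single_apply, eq_comm]
  rw [this, Pi.smul_apply, smul_eq_mul]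

/-- The homogeneous component of degree `a` of a morphism. -/
noncomputable def RegularMap.homogeneousComponent (φ : RegularMap n m) (a : ℕ) : RegularMap n m :=
  fun j => MvPolynomial.homogeneousComponent a (φ j)

/-- Linear maps commute with scaling, so coefficients in `t` can be compared along each line `t ↦ t
• v`. -/
theorem RegularMap.homogeneousComponent_toFun_apply_eq {φ : RegularMap n m} (a : ℕ)
    {A : (Fin n → ℂ) →ₗ[ℂ] (Fin n → ℂ)} {B : (Fin m → ℂ) →ₗ[ℂ] (Fin m → ℂ)}
    (h : ∀ v, φ.toFun (A v) = B (φ.toFun v)) (v : Fin n → ℂ) :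
    (φ.homogeneousComponent a).toFun (A v) = B ((φ.homogeneousComponent a).toFun v) := by
  funext j
  have hline : line (A v) (φ j) = ∑ i, line v (φ i) * Polynomial.C (B (Pi.single i 1) j) := by
    refine Polynomial.funext fun t => ?_
    have := congrFun (h (t • v)) j
    rw [map_smul, apply_eq_sum_mul_single B] at this
    simp only [RegularMap.toFun] at this
    simp only [eval_line, Polynomial.eval_finsetSum, Polynomial.eval_mul, Polynomial.eval_C, this]
  rw [apply_eq_sum_mul_single B]
  simp only [RegularMap.toFun, RegularMap.homogeneousComponent, ← coeff_line, hline,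
    Polynomial.finsetSum_coeff, Polynomial.coeff_mul_C]

end LeadingForms

/-! ### Composition, separation of points and generic points -/

section Morphisms

variable {l n m : ℕ}

/-- A linear map as a morphism of affine spaces. -/
noncomputable def RegularMap.ofLinear (A : (Fin n → ℂ) →ₗ[ℂ] (Fin m → ℂ)) : RegularMap n m :=
  fun j => ∑ i, X i * C (A (Pi.single i 1) j)

@[simp]
theorem RegularMap.ofLinear_toFun (A : (Fin n → ℂ) →ₗ[ℂ] (Fin m → ℂ)) (v : Fin n → ℂ) :
    (RegularMap.ofLinear A).toFun v = A v := by
  funext j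
  rw [apply_eq_sum_mul_single]
  simp [RegularMap.toFun, RegularMap.ofLinear]

/-- The composition of two morphisms. -/
noncomputable def RegularMap.comp (ψ : RegularMap n m) (φ : RegularMap l n) : RegularMap l m :=
  fun j => aeval φ (ψ j)

@[simp]
theorem RegularMap.comp_toFun (ψ : RegularMap n m) (φ : RegularMap l n) (v : Fin l → ℂ) :
    (ψ.comp φ).toFun v = ψ.toFun (φ.toFun v) := by
  funext j
  exact φ.eval_aeval _ v

theorem RegularMap.image_comp_subset (ψ : RegularMap n m) (φ : RegularMap l n) :
    (ψ.comp φ).image ⊆ ψ.image := by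
  rintro _ ⟨v, rfl⟩
  exact ⟨φ.toFun v, (ψ.comp_toFun φ v).symm⟩

theorem RegularMap.closureDim_image_comp_le (ψ : RegularMap n m) (φ : RegularMap l n) :
    closureDim (ψ.comp φ).image ≤ closureDim φ.image := by
  have : (ψ.comp φ).image = ψ.toFun '' φ.image := by
    rw [RegularMap.image, RegularMap.image, ← Set.range_comp]
    congr 1
    funext v
    simp
  rw [this]
  exact closureDim_image_le φ.isPrime_vanishingIdeal_image ψ

theorem RegularMap.exists_toFun_ne_zero_iff {φ : RegularMap n m} :
    (∃ v, φ.toFun v ≠ 0) ↔ φ ≠ 0 := by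
  constructor
  · rintro ⟨v, hv⟩ rfl
    exact hv (by funext j; simp [RegularMap.toFun])
  · intro h
    obtain ⟨j, hj⟩ := Function.ne_iff.1 h
    obtain ⟨v, hv⟩ := exists_eval_ne_zero hj
    exact ⟨v, fun h0 => hv (congrFun h0 j)⟩

theorem exists_eval_eq_one_of_notMem {S : Set (Fin n → ℂ)} (hS : S.Finite) {v : Fin n → ℂ}
    (hv : v ∉ S) : ∃ f : MvPolynomial (Fin n) ℂ, eval v f = 1 ∧ ∀ x ∈ S, eval x f = 0 := by
  induction S, hS using Set.Finite.induction_on with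
  | empty => exact ⟨1, by simp, by simp⟩
  | @insert x S _ _ ih =>
    rw [Set.mem_insert_iff, not_or] at hv
    obtain ⟨f, hf, hfS⟩ := ih hv.2
    obtain ⟨j, hj⟩ := Function.ne_iff.1 hv.1
    refine ⟨f * ((X j - C (x j)) * C (v j - x j)⁻¹), ?_, ?_⟩
    · simp [hf, mul_inv_cancel₀ (sub_ne_zero.2 hj)]
    · rintro y (rfl | hy)
      · simp
      · simp [hfS y hy]

theorem RationalMap.toFun_num {ψ : RationalMap n m} {v : Fin n → ℂ} (hv : v ∈ ψ.domain) :
    RegularMap.toFun ψ.num v = eval v ψ.den • ψ.toFun v := by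
  have hv' : eval v ψ.den ≠ 0 := hv
  funext j
  simp only [RegularMap.toFun, RationalMap.toFun, Pi.smul_apply, smul_eq_mul]
  field_simp

/-- Finitely many nonempty open subsets of an irreducible space have a common point; here a product
of nonzero polynomials is nonzero. -/
theorem RationalMap.exists_forall_apply_ne_zero {m' : ℕ} (ψ : RationalMap n m) {ι : Type*}
    [Finite ι] (B : ι → (Fin m → ℂ) →ₗ[ℂ] (Fin m' → ℂ))
    (h : ∀ i, ∃ v ∈ ψ.domain, B i (ψ.toFun v) ≠ 0) :
    ∃ v ∈ ψ.domain, ∀ i, B i (ψ.toFun v) ≠ 0 := by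
  classical
  have := Fintype.ofFinite ι
  have h2 : ∀ i, (RegularMap.ofLinear (B i)).comp ψ.num ≠ 0 := by
    intro i
    rw [← RegularMap.exists_toFun_ne_zero_iff]
    obtain ⟨v, hv, hBv⟩ := h i
    refine ⟨v, ?_⟩
    rw [RegularMap.comp_toFun, RegularMap.ofLinear_toFun, RationalMap.toFun_num hv, map_smul]
    exact smul_ne_zero hv hBv
  choose j hj using fun i => Function.ne_iff.1 (h2 i)
  obtain ⟨v, hv⟩ := exists_eval_ne_zero (mul_ne_zero ψ.den_ne_zero
    (Finset.prod_ne_zero_iff.2 fun i (_ : i ∈ Finset.univ) => hj i))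
  rw [map_mul, map_prod, mul_ne_zero_iff, Finset.prod_ne_zero_iff] at hv
  refine ⟨v, hv.1, fun i h0 => hv.2 i (Finset.mem_univ i) ?_⟩
  have : ((RegularMap.ofLinear (B i)).comp ψ.num).toFun v = 0 := by
    rw [RegularMap.comp_toFun, RegularMap.ofLinear_toFun, RationalMap.toFun_num hv.1, map_smul,
      h0, smul_zero]
  exact congrFun this (j i)

theorem RegularMap.exists_forall_apply_ne_zero {m' : ℕ} (φ : RegularMap n m) {ι : Type*}
    [Finite ι] (B : ι → (Fin m → ℂ) →ₗ[ℂ] (Fin m' → ℂ))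
    (h : ∀ i, ∃ v, B i (φ.toFun v) ≠ 0) : ∃ v, ∀ i, B i (φ.toFun v) ≠ 0 := by
  have := φ.toRationalMap.exists_forall_apply_ne_zero B
  simp only [φ.toRationalMap_toFun, φ.toRationalMap_domain, Set.mem_univ, true_and] at this
  exact this h

theorem homogeneousComponent_totalDegree_ne_zero {P : MvPolynomial (Fin n) ℂ} (hP : P ≠ 0) :
    homogeneousComponent P.totalDegree P ≠ 0 := by
  obtain ⟨d, hd, hdP⟩ := Finset.exists_mem_eq_sup P.support (support_nonempty.2 hP)
    (fun s => s.degree)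
  intro h
  have := congrArg (coeff d) h
  rw [coeff_homogeneousComponent, coeff_zero, if_pos] at this
  · exact (mem_support_iff.1 hd) this
  · exact hdP.symm

theorem RegularMap.exists_homogeneousComponent_ne_zero {φ : RegularMap n m} (hφ : φ ≠ 0) :
    ∃ a, (∀ j, (φ j).totalDegree ≤ a) ∧ φ.homogeneousComponent a ≠ 0 := by
  classical
  obtain ⟨j₀, hj₀⟩ := Function.ne_iff.1 hφ
  obtain ⟨j, hj, hmax⟩ := Finset.exists_max_image (Finset.univ.filter fun j => φ j ≠ 0)
    (fun j => (φ j).totalDegree) ⟨j₀, by simpa using hj₀⟩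
  refine ⟨(φ j).totalDegree, fun i => ?_, ?_⟩
  · by_cases hi : φ i = 0
    · simp [hi]
    · exact hmax i (by simpa using hi)
  · intro h
    exact homogeneousComponent_totalDegree_ne_zero (Finset.mem_filter.1 hj).2 (congrFun h j)

end Morphisms

/-! ### Interpolation and faithfulness of covariants -/

section Covariants

variable {G : Type*} [Group G] {l n m k : ℕ}

theorem IsCovariant.comp {ρ : Representation ℂ G (Fin l → ℂ)} {σ : Representation ℂ G (Fin n → ℂ)}
    {τ : Representation ℂ G (Fin m → ℂ)} {ψ : RegularMap n m} {φ : RegularMap l n}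
    (hψ : IsCovariant σ τ ψ) (hφ : IsCovariant ρ σ φ) : IsCovariant ρ τ (ψ.comp φ) := by
  intro g v
  rw [RegularMap.comp_toFun, hφ, hψ, RegularMap.comp_toFun]

theorem IsCovariant.homogeneousComponent {ρ : Representation ℂ G (Fin n → ℂ)}
    {σ : Representation ℂ G (Fin m → ℂ)} {φ : RegularMap n m} (hφ : IsCovariant ρ σ φ) (a : ℕ) :
    IsCovariant ρ σ (φ.homogeneousComponent a) :=
  fun g v => RegularMap.homogeneousComponent_toFun_apply_eq a (hφ g) v

/-- Take `f` equal to `1` at `v` and `0` on the rest of its free orbit, and form `x ↦ ∑ f(g⁻¹ x) • g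
w`. -/
theorem exists_isCovariant_toFun_eq [Finite G] (ρ : Representation ℂ G (Fin n → ℂ))
    (σ : Representation ℂ G (Fin m → ℂ)) {v : Fin n → ℂ} (hv : ∀ g, ρ g v = v → g = 1)
    (w : Fin m → ℂ) : ∃ φ : RegularMap n m, IsCovariant ρ σ φ ∧ φ.toFun v = w := by
  classical
  have := Fintype.ofFinite G
  obtain ⟨f, hf, hf0⟩ := exists_eval_eq_one_of_notMem (v := v)
    (S := (fun g => ρ g v) '' {g | g ≠ 1}) (Set.toFinite _) (by
      rintro ⟨g, hg, hgv⟩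
      exact hg (hv g hgv))
  let φ : RegularMap n m := fun j => ∑ g : G, aeval (RegularMap.ofLinear (ρ g⁻¹)) f * C (σ g w j)
  have hφ : ∀ x, φ.toFun x = ∑ g : G, eval (ρ g⁻¹ x) f • σ g w := by
    intro x
    funext j
    simp only [RegularMap.toFun, φ, map_sum, map_mul, eval_C, Finset.sum_apply, Pi.smul_apply,
      smul_eq_mul]
    refine Finset.sum_congr rfl fun g _ => ?_
    rw [RegularMap.eval_aeval, RegularMap.ofLinear_toFun]
  refine ⟨φ, fun h x => ?_, ?_⟩
  · rw [hφ, hφ, map_sum, ← Equiv.sum_comp (Equiv.mulLeft h)]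
    refine Finset.sum_congr rfl fun g _ => ?_
    rw [Equiv.coe_mulLeft, map_smul, mul_inv_rev, map_mul, map_mul, Module.End.mul_apply,
      Module.End.mul_apply, ← Module.End.mul_apply (ρ h⁻¹), ← map_mul, inv_mul_cancel, map_one,
      Module.End.one_apply]
  · rw [hφ, Finset.sum_eq_single 1]
    · simp [hf]
    · intro g _ hg
      rw [hf0 _ ⟨g⁻¹, inv_ne_one.2 hg, rfl⟩, zero_smul]
    · simp

/-- By irreducibility a stable set with a nonzero vector spans the module. -/
theorem eq_zero_of_forall_mem_eq_zero {σ : Representation ℂ G (Fin m → ℂ)} (hσ : σ.IsIrreducible)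
    {S : Set (Fin m → ℂ)} (hS : ∀ g, ∀ w ∈ S, σ g w ∈ S) {w : Fin m → ℂ} (hw : w ∈ S)
    (hw0 : w ≠ 0) {B : (Fin m → ℂ) →ₗ[ℂ] (Fin k → ℂ)} (hB : ∀ w ∈ S, B w = 0) : B = 0 := by
  let U : Subrepresentation σ := ⟨Submodule.span ℂ S, fun g v hv => by
    have : (Submodule.span ℂ S) ≤ (Submodule.span ℂ S).comap (σ g) :=
      Submodule.span_le.2 fun w hw => Submodule.subset_span (hS g w hw)
    exact this hv⟩
  have hU : U = ⊤ := by
    refine (hσ.eq_bot_or_eq_top U).resolve_left fun h => hw0 ?_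
    have hwU : w ∈ U := Submodule.subset_span hw
    rw [h] at hwU
    exact (Submodule.mem_bot ℂ).1 hwU
  have hspan : Submodule.span ℂ S = ⊤ := congrArg Subrepresentation.toSubmodule hU
  exact LinearMap.ext_on hspan hB

/-- An element fixing the image pointwise fixes its span, which is everything. Later constructions
therefore only have to stay nonzero. -/
theorem IsCovariant.actsFaithfullyOn {ρ : Representation ℂ G (Fin n → ℂ)}
    {σ : Representation ℂ G (Fin m → ℂ)} (hσ : σ.IsIrreducible) (hinj : Function.Injective σ)
    {φ : RegularMap n m} (hφ : IsCovariant ρ σ φ) (h0 : φ ≠ 0) : ActsFaithfullyOn σ φ.image := by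
  intro g hg
  obtain ⟨v, hv⟩ := RegularMap.exists_toFun_ne_zero_iff.2 h0
  have : σ g - 1 = 0 := by
    refine eq_zero_of_forall_mem_eq_zero hσ (S := φ.image) ?_ ⟨v, rfl⟩ hv fun w hw => ?_
    · rintro g _ ⟨v, rfl⟩
      exact ⟨ρ g v, hφ g v⟩
    · simp [hg w hw]
  exact hinj (by rw [map_one]; exact sub_eq_zero.1 this)

theorem eq_zero_of_forall_apply_eq [Nontrivial G] {σ : Representation ℂ G (Fin m → ℂ)}
    (hσ : σ.IsIrreducible) (hinj : Function.Injective σ) {w : Fin m → ℂ}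
    (hw : ∀ g, σ g w = w) : w = 0 := by
  by_contra hw0
  obtain ⟨g, hg⟩ := exists_ne (1 : G)
  have : σ g - 1 = 0 := eq_zero_of_forall_mem_eq_zero hσ (S := {w}) (by simpa using hw) rfl hw0
    (by simp [hw])
  exact hg (hinj (by rw [map_one]; exact sub_eq_zero.1 this))

theorem exists_ne_zero_of_isIrreducible {σ : Representation ℂ G (Fin m → ℂ)}
    (hσ : σ.IsIrreducible) : ∃ w : Fin m → ℂ, w ≠ 0 := by
  by_contra! h
  obtain ⟨U, V, hUV⟩ := hσ.toNontrivial
  exact hUV (SetLike.ext fun x => by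
    rw [h x]
    exact iff_of_true U.toSubmodule.zero_mem V.toSubmodule.zero_mem)

end Covariants

/-! ### The minima defining `covdim` and `edim` -/

section Dimensions

variable {G : Type*} [Group G] {n m k : ℕ}

theorem covdim_le_closureDim {ρ : Representation ℂ G (Fin n → ℂ)}
    {σ : Representation ℂ G (Fin m → ℂ)} {φ : RegularMap n m} (hφ : IsCovariant ρ σ φ)
    (hf : ActsFaithfullyOn σ φ.image) :
    ((covdim G : ℕ∞) : WithBot ℕ∞) ≤ closureDim φ.image := by
  obtain ⟨d, hd⟩ := closureDim_eq_natCast φ.isPrime_vanishingIdeal_image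
  rw [hd]
  have : covdim G ≤ d := Nat.sInf_le ⟨n, m, ρ, σ, φ, hφ, hf, hd⟩
  exact_mod_cast this

theorem edim_le_closureDim {ρ : Representation ℂ G (Fin n → ℂ)}
    {σ : Representation ℂ G (Fin m → ℂ)} {ψ : RationalMap n m} (hψ : IsRationalCovariant ρ σ ψ)
    (hf : ActsFaithfullyOn σ ψ.image) :
    ((edim G : ℕ∞) : WithBot ℕ∞) ≤ closureDim ψ.image := by
  obtain ⟨d, hd⟩ := closureDim_eq_natCast ψ.isPrime_vanishingIdeal_image
  rw [hd]
  have : edim G ≤ d := Nat.sInf_le ⟨n, m, ρ, σ, ψ, hψ, hf, hd⟩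
  exact_mod_cast this

theorem IsCovariant.isRationalCovariant {ρ : Representation ℂ G (Fin n → ℂ)}
    {σ : Representation ℂ G (Fin m → ℂ)} {φ : RegularMap n m} (hφ : IsCovariant ρ σ φ) :
    IsRationalCovariant ρ σ φ.toRationalMap := by
  intro g v _ _
  rw [φ.toRationalMap_toFun, hφ]

/-- The identity of a faithful module is a faithful covariant, so the infimum is attained rather
than being the default `0` of an empty set. -/
theorem exists_closureDim_eq_covdim {σ : Representation ℂ G (Fin k → ℂ)}
    (hσ : Function.Injective σ) :
    ∃ (n m : ℕ) (ρ : Representation ℂ G (Fin n → ℂ)) (τ : Representation ℂ G (Fin m → ℂ))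
      (φ : RegularMap n m), IsCovariant ρ τ φ ∧ ActsFaithfullyOn τ φ.image ∧
        closureDim φ.image = ((covdim G : ℕ∞) : WithBot ℕ∞) := by
  refine Nat.sInf_mem (s := {d : ℕ | ∃ (n m : ℕ) (ρ : Representation ℂ G (Fin n → ℂ))
    (τ : Representation ℂ G (Fin m → ℂ)) (φ : RegularMap n m), IsCovariant ρ τ φ ∧
      ActsFaithfullyOn τ φ.image ∧ closureDim φ.image = ((d : ℕ∞) : WithBot ℕ∞)}) ?_
  let φ : RegularMap k k := RegularMap.ofLinear LinearMap.id
  obtain ⟨d, hd⟩ := closureDim_eq_natCast φ.isPrime_vanishingIdeal_image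
  refine ⟨d, k, k, σ, σ, φ, fun g v => by simp [φ], fun g hg => hσ ?_, hd⟩
  rw [map_one]
  exact LinearMap.ext fun w => hg w ⟨w, by simp [φ]⟩

theorem exists_closureDim_eq_edim {σ : Representation ℂ G (Fin k → ℂ)}
    (hσ : Function.Injective σ) :
    ∃ (n m : ℕ) (ρ : Representation ℂ G (Fin n → ℂ)) (τ : Representation ℂ G (Fin m → ℂ))
      (ψ : RationalMap n m), IsRationalCovariant ρ τ ψ ∧ ActsFaithfullyOn τ ψ.image ∧
        closureDim ψ.image = ((edim G : ℕ∞) : WithBot ℕ∞) := by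
  refine Nat.sInf_mem (s := {d : ℕ | ∃ (n m : ℕ) (ρ : Representation ℂ G (Fin n → ℂ))
    (τ : Representation ℂ G (Fin m → ℂ)) (ψ : RationalMap n m), IsRationalCovariant ρ τ ψ ∧
      ActsFaithfullyOn τ ψ.image ∧ closureDim ψ.image = ((d : ℕ∞) : WithBot ℕ∞)}) ?_
  obtain ⟨n, m, ρ, τ, φ, hφ, hf, hd⟩ := exists_closureDim_eq_covdim hσ
  exact ⟨covdim G, n, m, ρ, τ, φ.toRationalMap, hφ.isRationalCovariant,
    φ.toRationalMap_image ▸ hf, φ.toRationalMap_image ▸ hd⟩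

theorem edim_le_covdim {σ : Representation ℂ G (Fin k → ℂ)} (hσ : Function.Injective σ) :
    edim G ≤ covdim G := by
  obtain ⟨n, m, ρ, τ, φ, hφ, hf, hd⟩ := exists_closureDim_eq_covdim hσ
  have := edim_le_closureDim hφ.isRationalCovariant (φ.toRationalMap_image ▸ hf)
  rw [φ.toRationalMap_image, hd] at this
  exact_mod_cast this

end Dimensions

/-! ### Reduction to self-covariants of a faithful irreducible module -/

section Reduction

variable {G : Type*} [Group G] {n m k : ℕ}

theorem exists_mem_domain_stabilizer_trivial [Finite G] {σ : Representation ℂ G (Fin m → ℂ)}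
    {ψ : RationalMap n m} (hf : ActsFaithfullyOn σ ψ.image) :
    ∃ v ∈ ψ.domain, ∀ g, σ g (ψ.toFun v) = ψ.toFun v → g = 1 := by
  obtain ⟨v, hv, h⟩ := ψ.exists_forall_apply_ne_zero (ι := {g : G // g ≠ 1})
    (fun g => σ g.1 - 1) (by
      rintro ⟨g, hg⟩
      by_contra! h
      refine hg (hf g ?_)
      rintro _ ⟨v, hv, rfl⟩
      simpa [sub_eq_zero] using h v hv)
  refine ⟨v, hv, fun g hg => ?_⟩
  by_contra hg1
  exact h ⟨g, hg1⟩ (by simp [hg])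

theorem exists_ne_zero_stabilizer_trivial [Finite G] {σ : Representation ℂ G (Fin k → ℂ)}
    (hσ : σ.IsIrreducible) (hinj : Function.Injective σ) :
    ∃ u : Fin k → ℂ, u ≠ 0 ∧ ∀ g, σ g u = u → g = 1 := by
  obtain ⟨w, hw⟩ := exists_ne_zero_of_isIrreducible hσ
  -- The index `none` imposes `u ≠ 0`, which the conditions indexed by `g ≠ 1` do not give when `G`
  -- is trivial.
  obtain ⟨u, hu⟩ := RegularMap.exists_forall_apply_ne_zero
    (RegularMap.ofLinear (LinearMap.id : (Fin k → ℂ) →ₗ[ℂ] _)) (ι := Option {g : G // g ≠ 1}) (fun x => x.elim LinearMap.id fun g => σ g.1 - 1) (by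
      rintro (_ | ⟨g, hg⟩)
      · exact ⟨w, by simpa using hw⟩
      · by_contra! h
        refine hg (hinj (LinearMap.ext fun v => ?_))
        simpa [sub_eq_zero] using h v)
  simp only [RegularMap.ofLinear_toFun, LinearMap.id_apply] at hu
  refine ⟨u, hu none, fun g hg => ?_⟩
  by_contra hg1
  exact hu (some ⟨g, hg1⟩) (by simp [hg])

/-- Both maps come from interpolation at points with trivial stabilizer; returning `u ≠ 0` to itself
keeps the sandwiched map nonzero. -/
theorem exists_covariants_comp_eq [Finite G] {σ : Representation ℂ G (Fin k → ℂ)}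
    (hσ : σ.IsIrreducible) (hinj : Function.Injective σ)
    {τ : Representation ℂ G (Fin m → ℂ)} (ρ : Representation ℂ G (Fin n → ℂ))
    {ψ : RationalMap n m} (hf : ActsFaithfullyOn τ ψ.image) :
    ∃ (α : RegularMap k n) (β : RegularMap m k) (u : Fin k → ℂ), IsCovariant σ ρ α ∧
      IsCovariant τ σ β ∧ u ≠ 0 ∧ α.toFun u ∈ ψ.domain ∧ β.toFun (ψ.toFun (α.toFun u)) = u := by
  obtain ⟨u, hu0, hu⟩ := exists_ne_zero_stabilizer_trivial hσ hinj
  obtain ⟨v, hv, hv'⟩ := exists_mem_domain_stabilizer_trivial hf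
  obtain ⟨α, hα, hαu⟩ := exists_isCovariant_toFun_eq σ ρ hu v
  obtain ⟨β, hβ, hβu⟩ := exists_isCovariant_toFun_eq τ σ hv' u
  exact ⟨α, β, u, hα, hβ, hu0, hαu ▸ hv, hαu ▸ hβu⟩

theorem IsCovariant.exists_homogeneous_self_covariant [Finite G] [Nontrivial G]
    {σ : Representation ℂ G (Fin k → ℂ)} (hσ : σ.IsIrreducible) (hinj : Function.Injective σ)
    {ρ : Representation ℂ G (Fin n → ℂ)} {τ : Representation ℂ G (Fin m → ℂ)}
    {φ : RegularMap n m} (hφ : IsCovariant ρ τ φ) (hf : ActsFaithfullyOn τ φ.image) :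
    ∃ (φ' : RegularMap k k) (d : ℕ), 0 < d ∧ (∀ j, (φ' j).IsHomogeneous d) ∧
      IsCovariant σ σ φ' ∧ φ' ≠ 0 ∧ closureDim φ'.image ≤ closureDim φ.image := by
  obtain ⟨α, β, u, hα, hβ, hu, -, hαβ⟩ := exists_covariants_comp_eq hσ hinj
    ρ (φ.toRationalMap_image ▸ hf)
  rw [φ.toRationalMap_toFun] at hαβ
  let p := β.comp (φ.comp α)
  have hp : IsCovariant σ σ p := hβ.comp (hφ.comp hα)
  have hp0 : p ≠ 0 := RegularMap.exists_toFun_ne_zero_iff.1 ⟨u, by simpa [p, hαβ] using hu⟩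
  have hpdim : closureDim p.image ≤ closureDim φ.image :=
    (RegularMap.closureDim_image_comp_le _ _).trans
      (closureDim_mono (RegularMap.image_comp_subset _ _))
  obtain ⟨a, ha, ha0⟩ := RegularMap.exists_homogeneousComponent_ne_zero hp0
  have ha1 : a ≠ 0 := by
    rintro rfl
    -- A constant covariant takes a value fixed by `G`, and the only such value is `0`.
    have hconst : ∀ v, p.toFun v = p.toFun 0 := by
      intro v
      funext j
      rw [RegularMap.toFun, RegularMap.toFun,
        totalDegree_eq_zero_iff_eq_C.1 (Nat.le_zero.1 (ha j)), eval_C, eval_C]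
    have h0 : p.toFun 0 = 0 := eq_zero_of_forall_apply_eq hσ hinj fun g => by
      rw [← hp, map_zero]
    obtain ⟨v, hv⟩ := RegularMap.exists_toFun_ne_zero_iff.2 hp0
    exact hv ((hconst v).trans h0)
  refine ⟨p.homogeneousComponent a, a, Nat.pos_of_ne_zero ha1,
    fun j => homogeneousComponent_isHomogeneous a _, hp.homogeneousComponent a, ha0,
    le_trans ?_ hpdim⟩
  rw [← p.toRationalMap_image]
  -- The denominator is `1`, of degree `0`, which differs from `a`.
  refine closureDim_image_homogeneousComponent_le p.toRationalMap (b := 0) ha ?_ ?_ ha1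
  · simp [RegularMap.toRationalMap]
  · simp [RegularMap.toRationalMap]

theorem isCovariant_of_forall_eval_ne_zero {ρ : Representation ℂ G (Fin n → ℂ)}
    {σ : Representation ℂ G (Fin m → ℂ)} {φ : RegularMap n m} {q : MvPolynomial (Fin n) ℂ}
    (hq : q ≠ 0) (h : ∀ g v, eval v q ≠ 0 → φ.toFun (ρ g v) = σ g (φ.toFun v)) :
    IsCovariant ρ σ φ := by
  intro g v
  have : φ.comp (RegularMap.ofLinear (ρ g)) = (RegularMap.ofLinear (σ g)).comp φ := by
    funext j
    refine sub_eq_zero.1 (eq_zero_of_forall_eval_ne_zero hq fun v hv => ?_)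
    have := congrFun (h g v hv) j
    rw [← RegularMap.ofLinear_toFun (ρ g), ← RegularMap.ofLinear_toFun (σ g),
      ← RegularMap.comp_toFun, ← RegularMap.comp_toFun] at this
    rw [map_sub, sub_eq_zero]
    exact this
  have := congrArg (fun f => RegularMap.toFun f v) this
  simpa using this

/-- Expand the fraction by the other conjugates of the denominator, which becomes its norm; the
domain may shrink but the values stay. -/
theorem IsRationalCovariant.exists_invariant_den [Finite G] {ρ : Representation ℂ G (Fin n → ℂ)}
    {σ : Representation ℂ G (Fin m → ℂ)} {ψ : RationalMap n m} (hψ : IsRationalCovariant ρ σ ψ) :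
    ∃ ψ' : RationalMap n m, IsCovariant ρ σ ψ'.num ∧
      (∀ g v, eval (ρ g v) ψ'.den = eval v ψ'.den) ∧ (ψ.num ≠ 0 → ψ'.num ≠ 0) ∧
      ψ'.image ⊆ ψ.image := by
  classical
  have := Fintype.ofFinite G
  let c : G → MvPolynomial (Fin n) ℂ := fun g => aeval (RegularMap.ofLinear (ρ g)) ψ.den
  have hc : ∀ g v, eval v (c g) = eval (ρ g v) ψ.den := fun g v => by
    rw [RegularMap.eval_aeval, RegularMap.ofLinear_toFun]
  have hc0 : ∀ g, c g ≠ 0 := by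
    intro g h
    obtain ⟨v, hv⟩ := exists_eval_ne_zero ψ.den_ne_zero
    refine hv ?_
    have := hc g (ρ g⁻¹ v)
    rw [← Module.End.mul_apply, ← map_mul, mul_inv_cancel, map_one, Module.End.one_apply, h,
      map_zero] at this
    exact this.symm
  have hprod : ∏ g, c g = (∏ g ∈ Finset.univ.erase 1, c g) * ψ.den := by
    rw [← Finset.prod_erase_mul _ _ (Finset.mem_univ (1 : G))]
    congr 1
    exact MvPolynomial.funext fun v => by simp [hc]
  have herase : ∏ g ∈ Finset.univ.erase 1, c g ≠ 0 := Finset.prod_ne_zero_iff.2 fun g _ => hc0 g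
  let ψ' : RationalMap n m := ⟨fun j => (∏ g ∈ Finset.univ.erase 1, c g) * ψ.num j, ∏ g, c g,
    Finset.prod_ne_zero_iff.2 fun g _ => hc0 g⟩
  have hinv : ∀ g v, eval (ρ g v) ψ'.den = eval v ψ'.den := by
    intro g v
    simp only [ψ', map_prod, hc]
    exact (Finset.prod_congr rfl fun h _ => by simp).trans
      (Equiv.prod_comp (Equiv.mulRight g) fun h => eval (ρ h v) ψ.den)
  have hdom : ∀ v ∈ ψ'.domain, v ∈ ψ.domain := by
    intro v hv h
    exact hv (by simp only [ψ', hprod, map_mul, h, mul_zero])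
  have hval : ∀ v ∈ ψ'.domain, ψ'.toFun v = ψ.toFun v := by
    intro v hv
    have hv' : eval v (∏ g ∈ Finset.univ.erase 1, c g) ≠ 0 := by
      intro h
      exact hv (by simp only [ψ', hprod, map_mul, h, zero_mul])
    funext j
    simp only [RationalMap.toFun, ψ', hprod]
    rw [map_mul, map_mul, mul_div_mul_left _ _ hv']
  have hdom' : ∀ g, ∀ v ∈ ψ'.domain, ρ g v ∈ ψ'.domain := by
    intro g v hv h
    exact hv (by rw [← hinv g v]; exact h)
  refine ⟨ψ', ?_, hinv, fun h0 h => h0 ?_, ?_⟩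
  · refine isCovariant_of_forall_eval_ne_zero ψ'.den_ne_zero fun g v hv => ?_
    have hgv := hdom' g v hv
    rw [RationalMap.toFun_num hgv, RationalMap.toFun_num hv, hval v hv, hval _ hgv, hinv, map_smul,
      hψ g v (hdom v hv) (hdom _ hgv)]
  · funext j
    exact (mul_eq_zero.1 (congrFun h j)).resolve_left herase
  · rintro _ ⟨v, hv, rfl⟩
    exact ⟨v, hdom v hv, (hval v hv).symm⟩

theorem IsRationalCovariant.exists_self_covariant [Finite G]
    {σ : Representation ℂ G (Fin k → ℂ)} (hσ : σ.IsIrreducible) (hinj : Function.Injective σ)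
    {ρ : Representation ℂ G (Fin n → ℂ)} {τ : Representation ℂ G (Fin m → ℂ)}
    {ψ : RationalMap n m} (hψ : IsRationalCovariant ρ τ ψ) (hf : ActsFaithfullyOn τ ψ.image) :
    ∃ ψ' : RationalMap k k, IsCovariant σ σ ψ'.num ∧
      (∀ g v, eval (σ g v) ψ'.den = eval v ψ'.den) ∧ ψ'.num ≠ 0 ∧
      closureDim ψ'.image ≤ closureDim ψ.image := by
  obtain ⟨α, β, u, hα, hβ, hu, hαu, hαβ⟩ := exists_covariants_comp_eq hσ hinj ρ hf
  have hden : aeval α ψ.den ≠ 0 := by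
    intro h
    refine hαu ?_
    rw [← α.eval_aeval, h, map_zero]
  let ψ₁ : RationalMap k m := ⟨RegularMap.comp ψ.num α, aeval α ψ.den, hden⟩
  have hdom₁ : ∀ v, v ∈ ψ₁.domain ↔ α.toFun v ∈ ψ.domain := fun v => by
    simp only [RationalMap.domain, ψ₁, Set.mem_ofPred_eq, α.eval_aeval]
  have hval₁ : ∀ v, ψ₁.toFun v = ψ.toFun (α.toFun v) := fun v => by
    funext j
    simp only [RationalMap.toFun, ψ₁, RegularMap.comp, α.eval_aeval]
  have him₁ : ψ₁.image ⊆ ψ.image := by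
    rintro _ ⟨v, hv, rfl⟩
    exact ⟨α.toFun v, (hdom₁ v).1 hv, (hval₁ v).symm⟩
  choose K hK using fun j => ψ₁.exists_eval_eq_pow_mul (β j)
  -- The `+ 1` keeps the exponent positive, so the new denominator has the same zeros as the old
  -- one.
  let K' := Finset.univ.sup K + 1
  choose r hr using fun j => hK j K'
    ((Finset.le_sup (Finset.mem_univ j)).trans (Nat.le_succ _))
  let ψ₂ : RationalMap k k := ⟨r, ψ₁.den ^ K', pow_ne_zero _ ψ₁.den_ne_zero⟩
  have hdom₂ : ∀ v, v ∈ ψ₂.domain ↔ v ∈ ψ₁.domain := fun v => by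
    simp [RationalMap.domain, ψ₂, K']
  have hval₂ : ∀ v ∈ ψ₁.domain, ψ₂.toFun v = β.toFun (ψ₁.toFun v) := by
    intro v hv
    have hv' : eval v ψ₁.den ≠ 0 := hv
    funext j
    simp only [RationalMap.toFun, ψ₂, hr j v hv, map_pow]
    rw [mul_div_cancel_left₀ _ (pow_ne_zero _ hv')]
    rfl
  have him₂ : ψ₂.image = β.toFun '' ψ₁.image := by
    ext x
    constructor
    · rintro ⟨v, hv, rfl⟩
      rw [hdom₂] at hv
      exact ⟨_, ⟨v, hv, rfl⟩, (hval₂ v hv).symm⟩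
    · rintro ⟨_, ⟨v, hv, rfl⟩, rfl⟩
      exact ⟨v, (hdom₂ v).2 hv, hval₂ v hv⟩
  have hψ₂ : IsRationalCovariant σ σ ψ₂ := by
    intro g v hv hgv
    rw [hdom₂] at hv hgv
    rw [hval₂ v hv, hval₂ _ hgv, hval₁, hval₁, hα]
    rw [hdom₁] at hv hgv
    rw [hα] at hgv
    rw [hψ g _ hv hgv, hβ]
  have hu₂ : u ∈ ψ₂.domain := (hdom₂ u).2 ((hdom₁ u).2 hαu)
  have hnum : ψ₂.num ≠ 0 := by
    refine RegularMap.exists_toFun_ne_zero_iff.1 ⟨u, ?_⟩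
    rw [RationalMap.toFun_num hu₂, hval₂ u ((hdom₂ u).1 hu₂), hval₁, hαβ]
    exact smul_ne_zero hu₂ hu
  obtain ⟨ψ₃, h1, h2, h3, h4⟩ := hψ₂.exists_invariant_den
  refine ⟨ψ₃, h1, h2, h3 hnum, (closureDim_mono h4).trans ?_⟩
  rw [him₂]
  exact (closureDim_image_le ψ₁.isPrime_vanishingIdeal_image β).trans (closureDim_mono him₁)

theorem IsCovariant.isRationalCovariant_of_invariant_den {ρ : Representation ℂ G (Fin n → ℂ)}
    {σ : Representation ℂ G (Fin m → ℂ)} {ψ : RationalMap n m} (hψ : IsCovariant ρ σ ψ.num)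
    (hden : ∀ g v, eval (ρ g v) ψ.den = eval v ψ.den) : IsRationalCovariant ρ σ ψ := by
  intro g v hv hgv
  have h := hψ g v
  rw [RationalMap.toFun_num hv, RationalMap.toFun_num hgv, hden, map_smul] at h
  exact smul_right_injective _ (show eval v ψ.den ≠ 0 from hv) h

theorem IsCovariant.actsFaithfullyOn_rationalMap {ρ : Representation ℂ G (Fin n → ℂ)}
    {σ : Representation ℂ G (Fin m → ℂ)} (hσ : σ.IsIrreducible) (hinj : Function.Injective σ)
    {ψ : RationalMap n m} (hψ : IsCovariant ρ σ ψ.num) (h0 : ψ.num ≠ 0) :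
    ActsFaithfullyOn σ ψ.image := by
  intro g hg
  refine hψ.actsFaithfullyOn hσ hinj h0 g ?_
  have : (RegularMap.ofLinear (σ g)).comp ψ.num = ψ.num := by
    funext j
    refine sub_eq_zero.1 (eq_zero_of_forall_eval_ne_zero ψ.den_ne_zero fun v hv => ?_)
    have h : ((RegularMap.ofLinear (σ g)).comp ψ.num).toFun v = RegularMap.toFun ψ.num v := by
      rw [RegularMap.comp_toFun, RegularMap.ofLinear_toFun, RationalMap.toFun_num hv, map_smul,
        hg _ ⟨v, hv, rfl⟩]
    rw [map_sub, sub_eq_zero]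
    exact congrFun h j
  rintro _ ⟨v, rfl⟩
  have := congrArg (fun f => RegularMap.toFun f v) this
  simpa using this

end Reduction

/-! ### Twisting by characters -/

section Twist

variable {G : Type*} [Group G] {n m k : ℕ}

/-- The twist of a representation by a character. -/
def twist (χ : G →* ℂˣ) (ρ : Representation ℂ G (Fin n → ℂ)) :
    Representation ℂ G (Fin n → ℂ) where
  toFun g := (χ g : ℂ) • ρ g
  map_one' := by simp
  map_mul' g h := by
    rw [map_mul, map_mul, Units.val_mul, smul_mul_smul_comm]

theorem twist_apply (χ : G →* ℂˣ) (ρ : Representation ℂ G (Fin n → ℂ)) (g : G) (v : Fin n → ℂ) :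
    twist χ ρ g v = (χ g : ℂ) • ρ g v := rfl

theorem isIrreducible_twist_comp {H : Type*} [Group H] {π : G →* H}
    (hπ : Function.Surjective π) (χ : G →* ℂˣ) {ρ : Representation ℂ H (Fin n → ℂ)}
    (hρ : ρ.IsIrreducible) : (twist χ (ρ.comp π)).IsIrreducible := by
  have e : ∀ U : Subrepresentation (twist χ (ρ.comp π)), ∃ V : Subrepresentation ρ,
      V.toSubmodule = U.toSubmodule := by
    intro U
    refine ⟨⟨U.toSubmodule, fun h v hv => ?_⟩, rfl⟩
    obtain ⟨g, rfl⟩ := hπ h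
    have := U.toSubmodule.smul_mem (χ g : ℂ)⁻¹ (U.apply_mem_toSubmodule g hv)
    rwa [twist_apply, inv_smul_smul₀ (Units.ne_zero _)] at this
  have : Nontrivial (Subrepresentation (twist χ (ρ.comp π))) := by
    obtain ⟨w, hw⟩ := exists_ne_zero_of_isIrreducible hρ
    refine ⟨⊥, ⊤, fun h => hw ?_⟩
    have hw' : w ∈ (⊤ : Subrepresentation (twist χ (ρ.comp π))) := Submodule.mem_top (R := ℂ)
    rw [← h] at hw'
    exact (Submodule.mem_bot ℂ).1 hw'
  refine ⟨fun U => ?_⟩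
  obtain ⟨V, hV⟩ := e U
  refine (hρ.eq_bot_or_eq_top V).imp (fun h => ?_) fun h => ?_
  · exact Subrepresentation.toSubmodule_injective (hV.symm.trans (congrArg _ h))
  · exact Subrepresentation.toSubmodule_injective (hV.symm.trans (congrArg _ h))

/-- An element acting by a scalar is central, by faithfulness. -/
theorem eq_one_of_smul_eq_one (hZ : Subgroup.center G = ⊥)
    {ρ : Representation ℂ G (Fin n → ℂ)} (hinj : Function.Injective ρ) {g : G} {c : ℂˣ}
    (h : (c : ℂ) • ρ g = 1) : g = 1 := by
  have hg : ρ g = (c : ℂ)⁻¹ • 1 := by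
    rw [← h, inv_smul_smul₀ c.ne_zero]
  have : g ∈ Subgroup.center G := by
    rw [Subgroup.mem_center_iff]
    intro x
    refine hinj ?_
    rw [map_mul, map_mul, hg, mul_smul_comm, smul_mul_assoc, mul_one, one_mul]
  rwa [hZ, Subgroup.mem_bot] at this

end Twist

/-! ### Homogeneous invariants of prescribed degree modulo `N` -/

section Invariants

variable {G : Type*} [Group G] {n k : ℕ}

/-- Let the `N`-th roots of unity act by scalars. As the center is trivial, `G × μ_N` still acts
faithfully on the span of the image of `φ`, so some image point has trivial stabilizer.
Interpolation there gives a semi-invariant of weight `ζ ^ r`, and a homogeneous component nonzero at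
that point has degree `d` with `ζ ^ d = ζ ^ r`. -/
theorem exists_homogeneous_invariant [Finite G] (hZ : Subgroup.center G = ⊥)
    {σ : Representation ℂ G (Fin k → ℂ)} (hσ : σ.IsIrreducible) (hinj : Function.Injective σ)
    {ρ : Representation ℂ G (Fin n → ℂ)} {φ : RegularMap n k} (hφ : IsCovariant ρ σ φ)
    (h0 : φ ≠ 0) (N : ℕ) [NeZero N] (r : ℕ) :
    ∃ (d : ℕ) (f : MvPolynomial (Fin k) ℂ), f.IsHomogeneous d ∧ d ≡ r [MOD N] ∧
      (∀ g v, eval (σ g v) f = eval v f) ∧ ∃ v, eval (φ.toFun v) f ≠ 0 := by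
  let χ : G × rootsOfUnity N ℂ →* ℂˣ :=
    (rootsOfUnity N ℂ).subtype.comp (MonoidHom.snd G (rootsOfUnity N ℂ))
  let τ : Representation ℂ (G × rootsOfUnity N ℂ) (Fin k → ℂ) :=
    twist χ (σ.comp (MonoidHom.fst G (rootsOfUnity N ℂ)))
  have hτ : ∀ x v, τ x v = ((x.2 : ℂˣ) : ℂ) • σ x.1 v := fun x v => rfl
  obtain ⟨v₀, hv₀⟩ := RegularMap.exists_toFun_ne_zero_iff.2 h0
  obtain ⟨v, hv⟩ := φ.exists_forall_apply_ne_zero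
    (ι := {x : G × rootsOfUnity N ℂ // x ≠ 1}) (fun x => τ x.1 - 1) (by
      rintro ⟨⟨g, ζ⟩, hx⟩
      by_contra! h
      have hB : τ (g, ζ) - 1 = 0 := by
        refine eq_zero_of_forall_mem_eq_zero hσ (S := φ.image) ?_ ⟨v₀, rfl⟩ hv₀ ?_
        · rintro g _ ⟨v, rfl⟩
          exact ⟨ρ g v, hφ g v⟩
        · rintro _ ⟨v, rfl⟩
          exact h v
      have hg : g = 1 := eq_one_of_smul_eq_one hZ hinj (c := (ζ : ℂˣ)) (sub_eq_zero.1 hB)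
      subst hg
      have h1 := h v₀
      rw [LinearMap.sub_apply, hτ, map_one, Module.End.one_apply, sub_eq_zero] at h1
      have h2 : ((ζ : ℂˣ) : ℂ) = 1 := by
        refine smul_left_injective ℂ hv₀ ?_
        simpa using h1
      refine hx (Prod.ext rfl ?_)
      exact Subtype.ext (Units.ext h2))
  obtain ⟨F, hF, hFv⟩ := exists_isCovariant_toFun_eq τ (twist (χ ^ r) (1 : Representation ℂ _
    (Fin 1 → ℂ))) (v := φ.toFun v) (fun x hx => by
      by_contra h
      exact hv ⟨x, h⟩ (by simp [hx])) 1
  obtain ⟨d, hd⟩ : ∃ d, eval (φ.toFun v) (homogeneousComponent d (F 0)) ≠ 0 := by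
    by_contra! h
    have h1 : eval (φ.toFun v) (F 0) = 1 := congrFun hFv 0
    rw [← sum_homogeneousComponent (F 0), map_sum, Finset.sum_eq_zero fun d _ => h d] at h1
    exact zero_ne_one h1
  have hcov : ∀ x w, eval (τ x w) (homogeneousComponent d (F 0)) =
      ((x.2 : ℂˣ) : ℂ) ^ r * eval w (homogeneousComponent d (F 0)) := by
    intro x w
    have := congrFun (hF.homogeneousComponent d x w) 0
    simpa [twist_apply, RegularMap.toFun, RegularMap.homogeneousComponent, χ] using this
  refine ⟨d, homogeneousComponent d (F 0), homogeneousComponent_isHomogeneous _ _, ?_, ?_, v, hd⟩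
  · have hζ := (Complex.isPrimitiveRoot_exp N (NeZero.ne N))
    set ζ := hζ.toRootsOfUnity with hζdef
    have hz := hcov (1, ζ) (φ.toFun v)
    rw [hτ, map_one, Module.End.one_apply,
      eval_smul_of_isHomogeneous (homogeneousComponent_isHomogeneous _ _)] at hz
    have hz' := mul_right_cancel₀ hd hz
    have hu : IsPrimitiveRoot (ζ : ℂˣ) N := IsPrimitiveRoot.coe_units_iff.1 hζ
    have hz'' : (ζ : ℂˣ) ^ d = (ζ : ℂˣ) ^ r := Units.ext (by simpa using hz')
    rwa [pow_eq_pow_iff_modEq, ← hu.eq_orderOf] at hz''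
  · intro g w
    have := hcov (g, 1) w
    rw [hτ] at this
    simpa using this

end Invariants

/-! ### Comparing `edim` and `covdim` -/

section EssentialDimension

variable {G : Type*} [Group G] [Finite G] {k : ℕ}

theorem edim_eq_covdim_of_nontrivial_center {σ : Representation ℂ G (Fin k → ℂ)}
    (hσ : σ.IsIrreducible) (hinj : Function.Injective σ) {z : G} (hz : z ≠ 1) {c : ℂ}
    (hc : ∀ v, σ z v = c • v) : edim G = covdim G := by
  refine le_antisymm (edim_le_covdim hinj) ?_
  obtain ⟨n, m, ρ, τ, ψ₀, hψ₀, hf, hd⟩ := exists_closureDim_eq_edim hinj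
  obtain ⟨ψ, hψ, hden, hnum, hdim⟩ := hψ₀.exists_self_covariant hσ hinj hf
  obtain ⟨a, ha, ha0⟩ := RegularMap.exists_homogeneousComponent_ne_zero hnum
  set b := ψ.den.totalDegree with hb
  have hb0 := homogeneousComponent_totalDegree_ne_zero ψ.den_ne_zero
  have hc1 : c ≠ 1 := by
    rintro rfl
    refine hz (hinj ?_)
    rw [map_one]
    exact LinearMap.ext fun v => by simp [hc]
  have hcov := hψ.homogeneousComponent a
  have hcovq : ∀ v, eval (σ z v) (homogeneousComponent b ψ.den) =
      eval v (homogeneousComponent b ψ.den) := by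
    intro v
    -- An invariant is a covariant to the trivial line, so its homogeneous components are invariant
    -- too.
    have hq : IsCovariant σ (1 : Representation ℂ G (Fin 1 → ℂ)) (fun _ => ψ.den) := by
      intro g v
      funext j
      simp [RegularMap.toFun, hden]
    exact congrFun (hq.homogeneousComponent b z v) 0
  have hca : c ^ a = c := by
    obtain ⟨v, hv⟩ := RegularMap.exists_toFun_ne_zero_iff.2 ha0
    have := hcov z v
    rw [hc, hc] at this
    refine smul_left_injective ℂ hv ?_
    refine Eq.trans ?_ this
    funext j
    exact (eval_smul_of_isHomogeneous (homogeneousComponent_isHomogeneous a _) c v).symm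
  have hcb : c ^ b = 1 := by
    obtain ⟨v, hv⟩ := exists_eval_ne_zero hb0
    have := hcovq v
    rw [hc, eval_smul_of_isHomogeneous (homogeneousComponent_isHomogeneous b _)] at this
    exact mul_right_cancel₀ hv (this.trans (one_mul _).symm)
  have hab : a ≠ b := by
    rintro rfl
    exact hc1 (hca.symm.trans hcb)
  have h1 := covdim_le_closureDim hcov (hcov.actsFaithfullyOn hσ hinj ha0)
  have h2 := h1.trans ((closureDim_image_homogeneousComponent_le ψ ha le_rfl hb0 hab).trans hdim)
  rw [hd] at h2
  exact_mod_cast h2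

theorem covdim_le_edim_add_one {σ : Representation ℂ G (Fin k → ℂ)}
    (hσ : σ.IsIrreducible) (hinj : Function.Injective σ) : covdim G ≤ edim G + 1 := by
  obtain ⟨n, m, ρ, τ, ψ₀, hψ₀, hf, hd⟩ := exists_closureDim_eq_edim hinj
  obtain ⟨ψ, hψ, hden, hnum, hdim⟩ := hψ₀.exists_self_covariant hσ hinj hf
  have h1 := covdim_le_closureDim hψ (hψ.actsFaithfullyOn hσ hinj hnum)
  have h2 : ((covdim G : ℕ∞) : WithBot ℕ∞) ≤ ((edim G : ℕ∞) : WithBot ℕ∞) + 1 := by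
    rw [← hd]
    exact h1.trans ((closureDim_image_num_le ψ).trans (by gcongr))
  exact_mod_cast h2

theorem RegularMap.toFun_smul_of_isHomogeneous {n m d : ℕ} {φ : RegularMap n m}
    (hφ : ∀ j, (φ j).IsHomogeneous d) (c : ℂ) (v : Fin n → ℂ) :
    φ.toFun (c • v) = c ^ d • φ.toFun v := by
  funext j
  exact eval_smul_of_isHomogeneous (hφ j) c v

/-- With invariants `A`, `C'` of degrees `D + 1`, `D`, rescale `φ` by `C'(φ) / A(φ)`. The image
stays in the cone `φ(V)` but now satisfies `A = C'`, a proper closed condition, so the dimension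
drops. -/
theorem edim_add_one_le_covdim_of_center_eq_bot [Nontrivial G] (hZ : Subgroup.center G = ⊥)
    {σ : Representation ℂ G (Fin k → ℂ)} (hσ : σ.IsIrreducible) (hinj : Function.Injective σ) :
    edim G + 1 ≤ covdim G := by
  obtain ⟨n, m, ρ, τ, φ₀, hφ₀, hf, hd⟩ := exists_closureDim_eq_covdim hinj
  obtain ⟨φ, d, hd0, hhom, hφ, hφ0, hdim⟩ := hφ₀.exists_homogeneous_self_covariant hσ hinj hf
  -- An odd degree is in particular nonzero, so `e` can serve as the next modulus.
  obtain ⟨e, B, hB, heB, hBinv, w, hw⟩ := exists_homogeneous_invariant hZ hσ hinj hφ hφ0 2 1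
  have he : NeZero e := ⟨by rintro rfl; exact absurd heB (by decide)⟩
  obtain ⟨e', A', hA', heA', hAinv', w', hw'⟩ :=
    exists_homogeneous_invariant hZ hσ hinj hφ hφ0 e 1
  -- Adding `e` keeps the degree at least `1` even when `e = 1` and `e' = 0`.
  obtain ⟨a, ha⟩ : ∃ a, e' + e = e * a + 1 := by
    have hmod : 1 ≡ e' + e [MOD e] := by
      simpa [Nat.ModEq] using heA'.symm
    obtain ⟨a, ha⟩ := (Nat.modEq_iff_dvd' (by have := NeZero.pos e; omega)).1 hmod
    exact ⟨a, by have := NeZero.pos e; omega⟩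
  have hB0 : aeval φ B ≠ 0 := fun h => hw (by rw [← φ.eval_aeval, h, map_zero])
  have hA0' : aeval φ A' ≠ 0 := fun h => hw' (by rw [← φ.eval_aeval, h, map_zero])
  set A := A' * B with hAdef
  set C' := B ^ a with hCdef
  have hA : A.IsHomogeneous (e * a + 1) := ha ▸ hA'.mul hB
  have hC : C'.IsHomogeneous (e * a) := hB.pow a
  have hA0 : aeval φ A ≠ 0 := by
    rw [hAdef, map_mul]
    exact mul_ne_zero hA0' hB0
  have hC0 : aeval φ C' ≠ 0 := by
    rw [hCdef, map_pow]
    exact pow_ne_zero _ hB0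
  have hAinv : ∀ g v, eval (σ g v) A = eval v A := fun g v => by simp [hAdef, hAinv', hBinv]
  have hCinv : ∀ g v, eval (σ g v) C' = eval v C' := fun g v => by simp [hCdef, hBinv]
  let ψ : RationalMap k k := ⟨fun j => aeval φ C' * φ j, aeval φ A, hA0⟩
  have hnum : ∀ v, RegularMap.toFun ψ.num v = eval (φ.toFun v) C' • φ.toFun v := by
    intro v
    funext j
    simp only [RegularMap.toFun, ψ, map_mul, Pi.smul_apply, smul_eq_mul]
    rw [φ.eval_aeval]
  have hval : ∀ v, ψ.toFun v = (eval (φ.toFun v) C' / eval (φ.toFun v) A) • φ.toFun v := by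
    intro v
    funext j
    simp only [RationalMap.toFun, ψ, map_mul, Pi.smul_apply, smul_eq_mul, φ.eval_aeval]
    rw [mul_div_right_comm]
    rfl
  have hcov : IsCovariant σ σ ψ.num := by
    intro g v
    rw [hnum, hnum, hφ, hCinv, map_smul]
  have hden : ∀ g v, eval (σ g v) ψ.den = eval v ψ.den := by
    intro g v
    simp only [ψ, φ.eval_aeval]
    rw [hφ, hAinv]
  have hψ0 : ψ.num ≠ 0 := by
    obtain ⟨j, hj⟩ := Function.ne_iff.1 hφ0
    exact fun h => mul_ne_zero hC0 hj (congrFun h j)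
  have hcone : ∀ (c : ℂ) v, c • φ.toFun v ∈ φ.image := by
    intro c v
    obtain ⟨t, rfl⟩ := IsAlgClosed.exists_pow_nat_eq c hd0
    exact ⟨t • v, RegularMap.toFun_smul_of_isHomogeneous hhom t v⟩
  have hsub : ψ.image ⊆ φ.image := by
    rintro _ ⟨v, -, rfl⟩
    rw [hval]
    exact hcone _ _
  have hvanish : ∀ x ∈ ψ.image, eval x (A - C') = 0 := by
    rintro _ ⟨v, hv, rfl⟩
    have hv' : eval (φ.toFun v) A ≠ 0 := fun h => hv (by simp only [ψ, φ.eval_aeval, h])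
    rw [hval, map_sub, eval_smul_of_isHomogeneous hA, eval_smul_of_isHomogeneous hC, pow_succ,
      mul_assoc, div_mul_cancel₀ _ hv', sub_self]
  -- The forms have different degrees, so they cannot agree both at a point where `A ≠ 0` and at its
  -- double.
  obtain ⟨x, hx, hx0⟩ : ∃ x ∈ φ.image, eval x (A - C') ≠ 0 := by
    obtain ⟨v, hv⟩ := exists_eval_ne_zero hA0
    rw [φ.eval_aeval] at hv
    by_contra! h
    have h1 := h _ ⟨v, rfl⟩
    have h2 := h _ (hcone 2 v)
    rw [map_sub, eval_smul_of_isHomogeneous hA, eval_smul_of_isHomogeneous hC] at h2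
    rw [map_sub, sub_eq_zero] at h1
    rw [← h1, pow_succ] at h2
    have h3 : (2 : ℂ) ^ (e * a) * eval (φ.toFun v) A = 0 := by linear_combination h2
    exact (mul_ne_zero (pow_ne_zero _ two_ne_zero) hv) h3
  have h1 := edim_le_closureDim (hcov.isRationalCovariant_of_invariant_den hden)
    (hcov.actsFaithfullyOn_rationalMap hσ hinj hψ0)
  have h2 := closureDim_add_one_le φ.isPrime_vanishingIdeal_image hsub _ hvanish hx hx0
  have h3 : ((edim G : ℕ∞) : WithBot ℕ∞) + 1 ≤ ((covdim G : ℕ∞) : WithBot ℕ∞) := by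
    rw [← hd]
    exact le_trans (by gcongr) (h2.trans hdim)
  exact_mod_cast h3

end EssentialDimension

/-! ### Passing between `G` and `G ⧸ Z(G)` -/

section CentralExtension

open scoped commutatorElement

variable {G : Type*} [Group G] {k : ℕ}

/-- If `g` is central modulo `Z(G)`, its commutators lie in `Z(G) ∩ [G, G]`, hence are trivial. -/
theorem center_quotient_center_eq_bot (hcomm : Subgroup.center G ⊓ commutator G = ⊥) :
    Subgroup.center (G ⧸ Subgroup.center G) = ⊥ := by
  rw [eq_bot_iff]
  intro x hx
  obtain ⟨g, rfl⟩ := QuotientGroup.mk_surjective x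
  rw [Subgroup.mem_bot, QuotientGroup.eq_one_iff, Subgroup.mem_center_iff]
  intro y
  have h1 : ⁅y, g⁆ ∈ Subgroup.center G := by
    rw [← QuotientGroup.eq_one_iff, ← QuotientGroup.mk'_apply, map_commutatorElement,
      commutatorElement_eq_one_iff_mul_comm]
    exact Subgroup.mem_center_iff.1 hx _
  have h2 : ⁅y, g⁆ ∈ Subgroup.center G ⊓ commutator G :=
    ⟨h1, Subgroup.commutator_mem_commutator (Subgroup.mem_top _) (Subgroup.mem_top _)⟩
  rw [hcomm, Subgroup.mem_bot, commutatorElement_eq_one_iff_mul_comm] at h2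
  exact h2

/-- The center embeds in the abelianization; identify it with a group of roots of unity and extend
that character from a subgroup of a finite abelian group. -/
theorem exists_character_injOn_center [Finite G] (hcyc : IsCyclic (Subgroup.center G))
    (hcomm : Subgroup.center G ⊓ commutator G = ⊥) :
    ∃ χ : G →* ℂˣ, ∀ z ∈ Subgroup.center G, χ z = 1 → z = 1 := by
  let Z := Subgroup.center G
  let ι : Z →* Abelianization G := Abelianization.of.comp Z.subtype
  have hι : Function.Injective ι := by
    rw [injective_iff_map_eq_one]
    rintro ⟨z, hz⟩ h
    have h1 : z ∈ commutator G := by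
      rw [← Abelianization.ker_of, MonoidHom.mem_ker]
      exact h
    have h2 : z ∈ Subgroup.center G ⊓ commutator G := ⟨hz, h1⟩
    rw [hcomm, Subgroup.mem_bot] at h2
    exact Subtype.ext h2
  have e : Z ≃* rootsOfUnity (Nat.card Z) ℂ := mulEquivOfCyclicCardEq (by
    rw [HasEnoughRootsOfUnity.natCard_rootsOfUnity])
  let χ₀ : Z →* ℂˣ := (rootsOfUnity (Nat.card Z) ℂ).subtype.comp e.toMonoidHom
  have hχ₀ : Function.Injective χ₀ := Subtype.val_injective.comp e.injective
  obtain ⟨χ₁, hχ₁⟩ := MonoidHom.domRestrict_surjective ℂ ι.range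
    (χ₀.comp (MonoidHom.ofInjective hι).symm.toMonoidHom)
  refine ⟨χ₁.comp Abelianization.of, fun z hz h => ?_⟩
  have h1 := DFunLike.congr_fun hχ₁ (MonoidHom.ofInjective hι ⟨z, hz⟩)
  have h2 : χ₀ ⟨z, hz⟩ = 1 := by
    simpa using h1.symm.trans h
  have h3 := hχ₀ (h2.trans (map_one χ₀).symm)
  exact congrArg Subtype.val h3

/-- The representation of `G` obtained from a representation of `G ⧸ Z(G)` and a character. -/
abbrev twistedInflation (χ : G →* ℂˣ)
    (τ : Representation ℂ (G ⧸ Subgroup.center G) (Fin k → ℂ)) :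
    Representation ℂ G (Fin k → ℂ) :=
  twist χ (τ.comp (QuotientGroup.mk' (Subgroup.center G)))

theorem twistedInflation_apply (χ : G →* ℂˣ)
    (τ : Representation ℂ (G ⧸ Subgroup.center G) (Fin k → ℂ)) (g : G) (v : Fin k → ℂ) :
    twistedInflation χ τ g v = (χ g : ℂ) • τ g v := rfl

theorem twistedInflation_injective {χ : G →* ℂˣ}
    (hZ : Subgroup.center (G ⧸ Subgroup.center G) = ⊥)
    (hχ : ∀ z ∈ Subgroup.center G, χ z = 1 → z = 1)
    {τ : Representation ℂ (G ⧸ Subgroup.center G) (Fin k → ℂ)} (hτ : τ.IsIrreducible)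
    (hinj : Function.Injective τ) : Function.Injective (twistedInflation χ τ) := by
  rw [injective_iff_map_eq_one]
  intro g hg
  have hg1 : (g : G ⧸ Subgroup.center G) = 1 := eq_one_of_smul_eq_one hZ hinj (c := χ g) hg
  refine hχ g ((QuotientGroup.eq_one_iff g).1 hg1) ?_
  obtain ⟨w, hw⟩ := exists_ne_zero_of_isIrreducible hτ
  have h := LinearMap.congr_fun hg w
  rw [twistedInflation_apply, hg1, map_one, Module.End.one_apply] at h
  refine Units.ext (smul_left_injective ℂ hw ?_)
  simpa using h

/-- A self-covariant of `χ ⊗ τ` of degree `d` is equivariant from `τ` to `χ ^ (1 - d) ⊗ τ`. As the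
center acts trivially through `τ` and the map is nonzero, this character descends to the quotient.
-/
theorem covdim_quotient_center_le [Finite G] [Nontrivial G]
    (hZ : Subgroup.center (G ⧸ Subgroup.center G) = ⊥) {χ : G →* ℂˣ}
    (hχ : ∀ z ∈ Subgroup.center G, χ z = 1 → z = 1)
    {τ : Representation ℂ (G ⧸ Subgroup.center G) (Fin k → ℂ)} (hτ : τ.IsIrreducible)
    (hinj : Function.Injective τ) : covdim (G ⧸ Subgroup.center G) ≤ covdim G := by
  have hσ := isIrreducible_twist_comp (QuotientGroup.mk'_surjective (Subgroup.center G)) χ hτ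
  have hσinj := twistedInflation_injective hZ hχ hτ hinj
  obtain ⟨n, m, ρ, σ', φ₀, hφ₀, hf, hd⟩ := exists_closureDim_eq_covdim hσinj
  obtain ⟨φ, d, -, hhom, hφ, hφ0, hdim⟩ := hφ₀.exists_homogeneous_self_covariant hσ hσinj hf
  have key : ∀ (g : G) v, φ.toFun (τ g v) =
      (((χ g)⁻¹ ^ d * χ g : ℂˣ) : ℂ) • τ g (φ.toFun v) := by
    intro g v
    have h := hφ g v
    rw [twist_apply, twist_apply, RegularMap.toFun_smul_of_isHomogeneous hhom] at h
    have h' : φ.toFun (τ g v) = ((χ g : ℂ) ^ d)⁻¹ • (χ g : ℂ) • τ g (φ.toFun v) := by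
      rw [eq_inv_smul_iff₀ (pow_ne_zero _ (Units.ne_zero _))]
      exact h
    rw [h', smul_smul]
    simp
  let χ₀ : G →* ℂˣ := χ⁻¹ ^ d * χ
  have hχ₀ : ∀ z ∈ Subgroup.center G, χ₀ z = 1 := by
    intro z hz
    obtain ⟨v, hv⟩ := RegularMap.exists_toFun_ne_zero_iff.2 hφ0
    have h := key z v
    rw [(QuotientGroup.eq_one_iff z).2 hz, map_one, Module.End.one_apply,
      Module.End.one_apply] at h
    refine Units.ext (smul_left_injective ℂ hv ?_)
    simpa [χ₀] using h.symm
  let χ' : G ⧸ Subgroup.center G →* ℂˣ := QuotientGroup.lift _ χ₀ hχ₀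
  let τ' := twist χ' (τ.comp (MonoidHom.id _))
  have hτ' : τ'.IsIrreducible := isIrreducible_twist_comp Function.surjective_id χ' hτ
  have hτinj : Function.Injective τ' := by
    rw [injective_iff_map_eq_one]
    intro h hh
    exact eq_one_of_smul_eq_one hZ hinj (c := χ' h) hh
  have hcov : IsCovariant τ τ' φ := by
    intro h v
    obtain ⟨g, rfl⟩ := QuotientGroup.mk_surjective h
    exact key g v
  have h1 := (covdim_le_closureDim hcov (hcov.actsFaithfullyOn hτ' hτinj hφ0)).trans hdim
  rw [hd] at h1
  exact_mod_cast h1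

/-- Multiply a self-covariant of `τ` of degree `d` by an invariant `f` so that the total degree is
`1` modulo `|G|`: then `χ` comes out to the power `1`, as `χ ⊗ τ` requires. -/
theorem covdim_le_covdim_quotient_center [Finite G] [Nontrivial (G ⧸ Subgroup.center G)]
    (hZ : Subgroup.center (G ⧸ Subgroup.center G) = ⊥) {χ : G →* ℂˣ}
    (hχ : ∀ z ∈ Subgroup.center G, χ z = 1 → z = 1)
    {τ : Representation ℂ (G ⧸ Subgroup.center G) (Fin k → ℂ)} (hτ : τ.IsIrreducible)
    (hinj : Function.Injective τ) : covdim G ≤ covdim (G ⧸ Subgroup.center G) := by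
  have hσ := isIrreducible_twist_comp (QuotientGroup.mk'_surjective (Subgroup.center G)) χ hτ
  have hσinj := twistedInflation_injective hZ hχ hτ hinj
  obtain ⟨n, m, ρ, σ', φ₀, hφ₀, hf, hd⟩ := exists_closureDim_eq_covdim hinj
  obtain ⟨φ, d, hd0, hhom, hφ, hφ0, hdim⟩ := hφ₀.exists_homogeneous_self_covariant hτ hinj hf
  have hid : IsCovariant τ τ (RegularMap.ofLinear LinearMap.id) := fun g v => by simp
  have hid0 : (RegularMap.ofLinear (LinearMap.id : (Fin k → ℂ) →ₗ[ℂ] _)) ≠ 0 := by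
    obtain ⟨w, hw⟩ := exists_ne_zero_of_isIrreducible hτ
    exact RegularMap.exists_toFun_ne_zero_iff.1 ⟨w, by simpa using hw⟩
  have hN : NeZero (Nat.card G) := ⟨Nat.card_pos.ne'⟩
  -- The residue is `1 - d` modulo `|G|`, written without subtracting `d`.
  obtain ⟨e, f, hfhom, he, hfinv, w, hw⟩ := exists_homogeneous_invariant hZ hτ hinj hid hid0
    (Nat.card G) (d * (Nat.card G - 1) + 1)
  have hf0 : f ≠ 0 := by
    rintro rfl
    exact hw (map_zero _)
  have hdeg : ∀ g : G, (χ g : ℂ) ^ (e + d) = χ g := by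
    intro g
    have h1 : χ g ^ Nat.card G = 1 := by rw [← map_pow, pow_card_eq_one', map_one]
    have h2 : e + d ≡ 1 [MOD Nat.card G] := by
      have h3 : d * (Nat.card G - 1) + 1 + d = 1 + d * Nat.card G := by
        obtain ⟨N, hN'⟩ : ∃ N, Nat.card G = N + 1 := ⟨_, (Nat.succ_pred hN.out).symm⟩
        rw [hN', Nat.add_sub_cancel]
        ring
      have h4 := he.add_right d
      rw [h3] at h4
      simpa [Nat.ModEq] using h4
    have h5 : χ g ^ (e + d) = χ g ^ 1 := by
      rw [pow_eq_pow_iff_modEq]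
      exact h2.of_dvd (orderOf_dvd_of_pow_eq_one h1)
    rw [pow_one] at h5
    exact_mod_cast congrArg Units.val h5
  let p : RegularMap k k := fun j => f * φ j
  have hp : ∀ v, p.toFun v = eval v f • φ.toFun v := by
    intro v
    funext j
    simp [p, RegularMap.toFun]
  have hpcov : IsCovariant (twistedInflation χ τ) (twistedInflation χ τ) p := by
    intro g v
    rw [hp, hp, twistedInflation_apply, twistedInflation_apply,
      eval_smul_of_isHomogeneous hfhom, RegularMap.toFun_smul_of_isHomogeneous hhom, hfinv, hφ,
      map_smul, smul_smul, smul_smul]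
    congr 1
    rw [mul_right_comm, ← pow_add, hdeg]
  have hp0 : p ≠ 0 := by
    obtain ⟨j, hj⟩ := Function.ne_iff.1 hφ0
    exact fun h => mul_ne_zero hf0 hj (congrFun h j)
  -- Viewing `φ` as `(f φ) / f`, the leading form of the numerator is `f φ`; the degrees `e + d` and
  -- `e` differ since `d > 0`, so `f φ` has no larger dimension than `φ`.
  let ψ : RationalMap k k := ⟨p, f, hf0⟩
  have hψ : ψ.image ⊆ φ.image := by
    rintro _ ⟨v, hv, rfl⟩
    refine ⟨v, ?_⟩
    have hv' : eval v f ≠ 0 := hv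
    funext j
    simp only [RationalMap.toFun, ψ, p, map_mul, RegularMap.toFun]
    rw [mul_div_cancel_left₀ _ hv']
  have hphom : ∀ j, (p j).IsHomogeneous (e + d) := fun j => hfhom.mul (hhom j)
  have hcomp : (fun j => homogeneousComponent (e + d) (ψ.num j)) = p :=
    funext fun j => homogeneousComponent_eq_self (hphom j)
  have h2 := closureDim_image_homogeneousComponent_le ψ (a := e + d) (b := e)
    (fun j => (hphom j).totalDegree_le) hfhom.totalDegree_le
    (by rw [homogeneousComponent_eq_self hfhom]; exact hf0) (by omega)
  rw [hcomp] at h2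
  have h1 := (covdim_le_closureDim hpcov (hpcov.actsFaithfullyOn hσ hσinj hp0)).trans
    (h2.trans ((closureDim_mono hψ).trans hdim))
  rw [hd] at h1
  exact_mod_cast h1

end CentralExtension

end CovDim

/-! ### Assembling the corollary -/

theorem corollary3p6 (G : Type*) [Group G] [Finite G]
    (hcyc : IsCyclic (Subgroup.center G))
    (hnontriv : Nontrivial (Subgroup.center G))
    (hcomm : Subgroup.center G ⊓ commutator G = ⊥)
    (hquot : CovDim.IsFaithfulGroup (G ⧸ Subgroup.center G)) :
    CovDim.IsFaithfulGroup G ∧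
      ((∃ a b : G, a * b ≠ b * a) →
        CovDim.edim G = CovDim.covdim G ∧
        CovDim.covdim G = CovDim.covdim (G ⧸ Subgroup.center G) ∧
        CovDim.covdim (G ⧸ Subgroup.center G) =
          CovDim.edim (G ⧸ Subgroup.center G) + 1) := by
  obtain ⟨k, τ, hτ, hinj⟩ := hquot
  have hZ := CovDim.center_quotient_center_eq_bot hcomm
  obtain ⟨χ, hχ⟩ := CovDim.exists_character_injOn_center hcyc hcomm
  have hσ := CovDim.isIrreducible_twist_comp
    (QuotientGroup.mk'_surjective (Subgroup.center G)) χ hτ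
  have hσinj := CovDim.twistedInflation_injective hZ hχ hτ hinj
  refine ⟨⟨k, CovDim.twistedInflation χ τ, hσ, hσinj⟩, ?_⟩
  rintro ⟨a, b, hab⟩
  have hG : Nontrivial G := ⟨_, _, hab⟩
  have hQ : Nontrivial (G ⧸ Subgroup.center G) := by
    refine ⟨a, 1, fun h => hab ?_⟩
    exact (Subgroup.mem_center_iff.1 ((QuotientGroup.eq_one_iff a).1 h) b).symm
  obtain ⟨⟨z, hz⟩, hz1⟩ := exists_ne (1 : Subgroup.center G)
  refine ⟨CovDim.edim_eq_covdim_of_nontrivial_center hσ hσinj (z := z) (c := χ z)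
      (fun h => hz1 (Subtype.ext h)) fun v => ?_, le_antisymm
      (CovDim.covdim_le_covdim_quotient_center hZ hχ hτ hinj)
      (CovDim.covdim_quotient_center_le hZ hχ hτ hinj), le_antisymm
      (CovDim.covdim_le_edim_add_one hτ hinj)
      (CovDim.edim_add_one_le_covdim_of_center_eq_bot hZ hτ hinj)⟩
  rw [CovDim.twistedInflation_apply, (QuotientGroup.eq_one_iff z).2 hz, map_one,
    Module.End.one_apply]
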